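/- Let $E=K_1\times\cdots\times K_m$ be a CM algebra (a finite product of CM fields), let $\Phi\subset\mathrm{Hom}(E,\mathbb C)$ be a CM type, i.e. $\mathrm{Hom}(E,\mathbb C)=\Phi\sqcup\overline\Phi$, and let $A=V/\Lambda$ be an abelian variety over $\mathbb C$ with an isogeny $A\to A_{(E,\Phi)}=\mathbb C^{\Phi}/\Phi(\mathcal O_E)$. Through the isogeny $E$ acts on $H^1(A,\mathbb Q)$; for each $\phi\in\mathrm{Hom}(E,\mathbb C)$ write again $\phi\in H^1(A,\mathbb C)$ for a chosen non-zero eigenvector on which $E$ acts by $\phi$. Let $\psi$ be a polarization of $H^1(A,\mathbb Q)$, let $E^\times=\mathrm{Res}_{E/\mathbb Q}\mathbb G_m\subset \mathrm{GL}(H^1(A,\mathbb Q))$ and $T=E^\times\cap\mathrm{GSp}(H^1(A,\mathbb Q),\psi)$, let $\epsilon_0\in X^*(T)$ be the similitude character, and regard each $\phi\in\Phi$ as a character of $T$ (the one by which $T$ acts on the eigenvector $\phi$). Let $\mathrm{MT}(A)\subseteq T$ be the Mumford--Tate group and $$N=\ker\big(X^*(T)\to X^*(\mathrm{MT}(A))\big).$$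 For $n\ge 1$ let $X^*(T)_n$ be the set of $\alpha=\sum_{\phi\in\Phi}a_\phi\phi+a\epsilon_0\in X^*(T)$ with $|a_\phi|\le n$ for all $\phi$. For $\phi\in\mathrm{Hom}(E,\mathbb C)$ and $1\le\ell\le n$ let $\phi^{(\ell)}\in H^1(A^n,\mathbb C)$ be the pull-back of $\phi$ under the $\ell$-th projection $A^n\to A$. Fix a total order on $\{\phi^{(\ell)}\}=\Phi^{\sqcup n}\sqcup\overline\Phi^{\sqcup n}$, and for a subset $P$ let $[P]\in H^*(A^n,\mathbb C)=\bigwedge H^1(A^n,\mathbb C)$ be the wedge product of the elements of $P$ in increasing order. Let $B(A^n)=\bigoplus_p B^p(A^n)$, with $B^p(A^n)=H^{p,p}(A^n,\mathbb C)\cap H^{2p}(A^n,\mathbb Q)$, be the Hodge ring, and regard $B(A^n)\otimes\mathbb C$ as a subspace of $H^*(A^n,\mathbb C)$. For $\alpha=\sum_{\phi\in\Phi} a_\phi\phi+a\epsilon_0\in N\cap X^*(T)_n$ let $P_\alpha$ be any subset of $\Phi^{\sqcup n}\sqcup\overline\Phi^{\sqcup n}$ which, for each $\phi\in\Phi$,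 contains exactly $\max(a_\phi,0)$ of the elements $\phi^{(1)},\dots,\phi^{(n)}$ and exactly $\max(-a_\phi,0)$ of the elements $\overline{\phi}^{(1)},\dots,\overline{\phi}^{(n)}$. Then: 1. $[P_\alpha]\in B(A^n)\otimes\mathbb C$ for every $\alpha\in N\cap X^*(T)_n$ and every choice of $P_\alpha$. 2. $B(A^n)\otimes\mathbb C$ has a $\mathbb C$-basis formed by the products of the classes $[P_\alpha]$ with classes $\phi^{(\ell)}\wedge\overline{\phi}^{(\ell')}$ ($\phi\in\Phi$, $1\le\ell,\ell'\le n$). Precisely: call $Q$ admissible if it is a disjoint union $$Q=P_\alpha\sqcup\{\phi_1^{(\ell_1)},\overline{\phi_1}^{(\ell_1')}\}\sqcup\cdots\sqcup\{\phi_r^{(\ell_r)},\overline{\phi_r}^{(\ell_r')}\}$$ for some $\alpha\in N\cap X^*(T)_n$, some choice of $P_\alpha$, some $r\ge0$, $\phi_i\in\Phi$ and $\ell_i,\ell_i'\in\{1,\dots,n\}$. For each such decomposition $$[P_\alpha]\wedge\phi_1^{(\ell_1)}\wedge\overline{\phi_1}^{(\ell_1')}\wedge\cdots\wedge\phi_r^{(\ell_r)}\wedge\overline{\phi_r}^{(\ell_r')}=\pm[Q],$$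 and the classes $[Q]$, for $Q$ running once through all admissible sets, form a basis of the $\mathbb C$-vector space $B(A^n)\otimes\mathbb C$. -/

import Mathlib

/-!
Complex tori `V / Λ`, their rational Hodge structure, Mumford-Tate group, Hodge ring, and the
combinatorial classes attached to characters of the torus of a CM pair.

The cohomology of the torus `V / Λ` is used in its standard linear-algebraic form:
`H¹(V/Λ, ℂ) = Hom_ℝ(V, ℂ)`, with `H¹(V/Λ, ℚ)` the forms that are rational on `Λ`, and
`H^*(V/Λ, ℂ)` the exterior algebra on `H¹(V/Λ, ℂ)`, with cup product the wedge product.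
-/

open scoped ComplexConjugate

noncomputable section

namespace CMHodge

section Cohomology

variable {V : Type*} [AddCommGroup V] [Module ℂ V]

/-- `H¹(V/Λ, ℂ) = Hom(Λ, ℂ) = Hom_ℝ(V, ℂ)`. -/
abbrev H1 (V : Type*) [AddCommGroup V] [Module ℂ V] : Type _ := V →ₗ[ℝ] ℂ

/-- `H^*(V/Λ, ℂ) = ⋀ H¹(V/Λ, ℂ)`. -/
abbrev Coh (V : Type*) [AddCommGroup V] [Module ℂ V] : Type _ := ExteriorAlgebra ℂ (H1 V)

/-- `H¹(V/Λ, ℚ) = Hom(Λ, ℚ)`, as a subspace of `H¹(V/Λ, ℂ)`. -/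
def ratH1 (Λ : Submodule ℤ V) : Submodule ℚ (H1 V) where
  carrier := {v | ∀ x ∈ Λ, ∃ q : ℚ, v x = (q : ℂ)}
  zero_mem' := fun _ _ => ⟨0, by simp⟩
  add_mem' := by
    intro v w hv hw x hx
    obtain ⟨q, hq⟩ := hv x hx
    obtain ⟨r, hr⟩ := hw x hx
    exact ⟨q + r, by simp [hq, hr]⟩
  smul_mem' := by
    intro c v hv x hx
    obtain ⟨q, hq⟩ := hv x hx
    exact ⟨c * q, by simp [hq, Rat.smul_def]⟩

/-- `H^{1,0}`: the complex linear forms on `V`. -/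
def H10 (V : Type*) [AddCommGroup V] [Module ℂ V] : Submodule ℂ (H1 V) where
  carrier := {v | ∀ (z : ℂ) (x : V), v (z • x) = z * v x}
  zero_mem' := by intro z x; simp
  add_mem' := by
    intro v w hv hw z x
    simp [hv z x, hw z x, mul_add]
  smul_mem' := by
    intro c v hv z x
    simp [hv z x, mul_left_comm]

/-- `H^{0,1}`: the conjugate linear forms on `V`. -/
def H01 (V : Type*) [AddCommGroup V] [Module ℂ V] : Submodule ℂ (H1 V) where
  carrier := {v | ∀ (z : ℂ) (x : V), v (z • x) = conj z * v x}
  zero_mem' := by intro z x; simp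
  add_mem' := by
    intro v w hv hw z x
    simp [hv z x, hw z x, mul_add]
  smul_mem' := by
    intro c v hv z x
    simp [hv z x, mul_left_comm]

/-- `H^{p,q} = ⋀^p H^{1,0} ⊗ ⋀^q H^{0,1}` inside the total cohomology: the span of the wedge
products of `p` classes in `H^{1,0}` and `q` classes in `H^{0,1}`. -/
def hodgePart (V : Type*) [AddCommGroup V] [Module ℂ V] (p q : ℕ) : Submodule ℂ (Coh V) :=
  ((H10 V).map (ExteriorAlgebra.ι ℂ)) ^ p * ((H01 V).map (ExteriorAlgebra.ι ℂ)) ^ q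

/-- `H^r(V/Λ, ℚ)` inside `H^*(V/Λ, ℂ)`: the rational span of the wedge products of `r` classes in
`H¹(V/Λ, ℚ)`. -/
def ratCoh (Λ : Submodule ℤ V) (r : ℕ) : Submodule ℚ (Coh V) :=
  ((ratH1 Λ).map ((ExteriorAlgebra.ι ℂ : H1 V →ₗ[ℂ] Coh V).restrictScalars ℚ)) ^ r

/-- `B^p = H^{p,p} ∩ H^{2p}(ℚ)`, the rational Hodge classes of type `(p,p)`. -/
def hodgeClasses (Λ : Submodule ℤ V) (p : ℕ) : Submodule ℚ (Coh V) :=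
  (hodgePart V p p).restrictScalars ℚ ⊓ ratCoh Λ (2 * p)

/-- The Hodge ring `B = ⨁_{p = 0}^{dim} B^p`. -/
def hodgeRing (Λ : Submodule ℤ V) : Submodule ℚ (Coh V) :=
  ⨆ p ∈ Finset.range (Module.finrank ℂ V + 1), hodgeClasses Λ p

/-- `B ⊗ ℂ`, as a subspace of `H^*(V/Λ, ℂ) = H^*(V/Λ, ℚ) ⊗ ℂ`. -/
def hodgeRingC (Λ : Submodule ℤ V) : Submodule ℂ (Coh V) :=
  Submodule.span ℂ (hodgeRing Λ : Set (Coh V))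

end Cohomology

section Groups

variable {V : Type*} [AddCommGroup V] [Module ℂ V]

/-- `GL(H¹(ℚ))(ℂ) = GL(H¹(ℂ))`. -/
abbrev GLH1 (V : Type*) [AddCommGroup V] [Module ℂ V] : Type _ := H1 V ≃ₗ[ℂ] H1 V

/-- The action on `H¹` of an endomorphism of `V`, by pull-back. -/
def pullback (u : V →ₗ[ℂ] V) : H1 V →ₗ[ℂ] H1 V where
  toFun v := v ∘ₗ u.restrictScalars ℝ
  map_add' _ _ := rfl
  map_smul' _ _ := rfl

/-- The Hodge structure `ℂ^× = 𝕊(ℝ) → GL(H¹)`: `z` acts on `H^{1,0}` by multiplication by `z` and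
on `H^{0,1}` by multiplication by the conjugate of `z`. -/
def hodgeAct (z : ℂˣ) : GLH1 V :=
  LinearEquiv.ofLinearMap (pullback ((z : ℂ) • LinearMap.id))
    (pullback (((z⁻¹ : ℂˣ) : ℂ) • LinearMap.id))
    (by ext v x; simp [pullback, smul_smul]) (by ext v x; simp [pullback, smul_smul])

/-- The matrix coefficients of `g ∈ GL(H¹(ℂ))` for the rational structure: `v ∈ H¹(ℚ)` is paired,
after `g`, with `x ∈ Λ = H_1(ℤ)`. -/
def coeff (Λ : Submodule ℤ V) (g : GLH1 V) (i : ratH1 Λ × Λ) : ℂ :=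
  (g (i.1 : H1 V)) (i.2 : V)

/-- `G ⊆ GL(H¹(ℂ))` is (the group of complex points of) an algebraic subgroup of `GL(H¹(ℚ))` that is
defined over `ℚ`: it is cut out by polynomials with rational coefficients. -/
def IsAlgebraicOverQ (Λ : Submodule ℤ V) (G : Subgroup (GLH1 V)) : Prop :=
  ∃ S : Set (MvPolynomial (ratH1 Λ × Λ) ℚ),
    ∀ g : GLH1 V, g ∈ G ↔ ∀ p ∈ S, MvPolynomial.aeval (coeff Λ g) p = 0

/-- The Mumford-Tate group (its complex points): the smallest algebraic subgroup of `GL(H¹(ℚ))` over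
`ℚ` through which the Hodge structure factors. -/
def mumfordTate (Λ : Submodule ℤ V) : Subgroup (GLH1 V) :=
  sInf {G | IsAlgebraicOverQ Λ G ∧ ∀ z : ℂˣ, hodgeAct z ∈ G}

/-- `ψ` is (the complexification of) a polarization of the rational Hodge structure `H¹(ℚ)`. -/
structure IsPolarization (Λ : Submodule ℤ V) (ψ : LinearMap.BilinForm ℂ (H1 V)) : Prop where
  rational : ∀ x ∈ ratH1 Λ, ∀ y ∈ ratH1 Λ, ∃ q : ℚ, ψ x y = (q : ℂ)
  alternating : ∀ x, ψ x x = 0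
  hodge : ∀ (z : ℂˣ) (x y : H1 V),
    ψ (hodgeAct z x) (hodgeAct z y) = ((z : ℂ) * conj (z : ℂ)) * ψ x y
  positive : ∀ x : H1 V, (∀ v, (x v).im = 0) → x ≠ 0 →
    0 < (ψ x (hodgeAct (Units.mk0 Complex.I Complex.I_ne_zero) x)).re

/-- `t` is a similitude of `ψ` with multiplier `c`. -/
def IsSimilitude (ψ : LinearMap.BilinForm ℂ (H1 V)) (t : GLH1 V) (c : ℂˣ) : Prop :=
  ∀ x y, ψ (t x) (t y) = (c : ℂ) * ψ x y

/-- `GSp(H¹, ψ)`, complex points. -/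
def GSp (ψ : LinearMap.BilinForm ℂ (H1 V)) : Subgroup (GLH1 V) where
  carrier := {t | ∃ c : ℂˣ, IsSimilitude ψ t c}
  one_mem' := ⟨1, fun x y => by simp⟩
  mul_mem' := by
    rintro s t ⟨c, hc⟩ ⟨d, hd⟩
    refine ⟨c * d, fun x y => ?_⟩
    rw [LinearEquiv.mul_apply, LinearEquiv.mul_apply, hc, hd]
    push_cast
    ring
  inv_mem' := by
    rintro t ⟨c, hc⟩
    refine ⟨c⁻¹, fun x y => ?_⟩
    have h := hc (t⁻¹ x) (t⁻¹ y)
    have hx : ∀ w, t (t⁻¹ w) = w := fun w => t.apply_symm_apply w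
    rw [hx, hx] at h
    rw [h, ← mul_assoc, ← Units.val_mul, inv_mul_cancel, Units.val_one, one_mul]

/-- The characters of the algebraic group with complex points `T ⊆ GL(H¹(ℂ))`: the homomorphisms
`T → ℂ^×` given by a regular function, that is, by a polynomial in the matrix coefficients of `t`
and `t⁻¹`. -/
def algCharacters (Λ : Submodule ℤ V) (T : Subgroup (GLH1 V)) : Set (T →* ℂˣ) :=
  {α | ∃ p : MvPolynomial ((ratH1 Λ × Λ) ⊕ (ratH1 Λ × Λ)) ℂ, ∀ t : T,
    ((α t : ℂˣ) : ℂ) =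
      MvPolynomial.aeval (Sum.elim (coeff Λ (t : GLH1 V)) (coeff Λ ((t : GLH1 V)⁻¹))) p}

/-- `N`: the kernel of the restriction of characters from `T` to the Mumford-Tate group. -/
def kernelN (Λ : Submodule ℤ V) (T : Subgroup (GLH1 V)) : Set (T →* ℂˣ) :=
  {α | α ∈ algCharacters Λ T ∧ ∀ t : T, (t : GLH1 V) ∈ mumfordTate Λ → α t = 1}

end Groups

section Tori

/-- A (linear lift of an) isogeny `V/Λ → W/Γ` of complex tori: an isomorphism of complex vector
spaces that maps `Λ` into `Γ`. For full lattices the index of the image is automatically finite. -/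
structure Isogeny {V W : Type*} [AddCommGroup V] [Module ℂ V] [AddCommGroup W] [Module ℂ W]
    (Λ : Submodule ℤ V) (Γ : Submodule ℤ W) where
  toEquiv : V ≃ₗ[ℂ] W
  map_mem : ∀ x ∈ Λ, toEquiv x ∈ Γ

/-- The lattice of the `n`-th power of the torus `V/Λ`. -/
def powLattice {V : Type*} [AddCommGroup V] [Module ℂ V] (Λ : Submodule ℤ V) (n : ℕ) :
    Submodule ℤ (Fin n → V) :=
  Submodule.pi Set.univ fun _ => Λ

end Tori

section CMPair

variable {E : Type*} [CommRing E]

/-- The complex conjugate of a complex embedding. -/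
def conjHom (φ : E →+* ℂ) : E →+* ℂ := (starRingEnd ℂ).comp φ

/-- `Φ` is a CM type: `Hom(E, ℂ)` is the disjoint union of `Φ` and its complex conjugate. -/
def IsCMType (Φ : Finset (E →+* ℂ)) : Prop :=
  ∀ φ : E →+* ℂ, φ ∈ Φ ↔ conjHom φ ∉ Φ

/-- The image `Φ(𝒪_E)` in `ℂ^Φ` of the ring of integers of `E`; the quotient `ℂ^Φ / Φ(𝒪_E)` is the
complex torus `A_{(E,Φ)}`. -/
def cmLattice (Φ : Finset (E →+* ℂ)) : Submodule ℤ (Φ → ℂ) where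
  carrier := {w | ∃ e ∈ integralClosure ℤ E, ∀ φ : Φ, w φ = (φ : E →+* ℂ) e}
  zero_mem' := ⟨0, Subalgebra.zero_mem _, fun φ => by simp⟩
  add_mem' := by
    rintro v w ⟨e, he, hv⟩ ⟨e', he', hw⟩
    exact ⟨e + e', Subalgebra.add_mem _ he he', fun φ => by simp [hv φ, hw φ]⟩
  smul_mem' := by
    rintro c w ⟨e, he, hw⟩
    exact ⟨c • e, Subalgebra.smul_mem _ he c, fun φ => by simp [hw φ]⟩

variable {V : Type*} [AddCommGroup V] [Module ℂ V] {Λ : Submodule ℤ V} {Φ : Finset (E →+* ℂ)}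

/-- The action of `e ∈ E` on `V` (by an element of `End(V/Λ) ⊗ ℚ`) that corresponds under the
isogeny `f` to the action of `e` on `ℂ^Φ` by multiplication by `φ(e)` in the coordinate `φ`. -/
def cmAct (f : Isogeny Λ (cmLattice Φ)) (e : E) : V →ₗ[ℂ] V :=
  f.toEquiv.symm.toLinearMap ∘ₗ
    LinearMap.pi (fun φ : Φ => ((φ : E →+* ℂ) e) • LinearMap.proj φ) ∘ₗ f.toEquiv.toLinearMap

/-- `φ ↦ ω φ` is an eigenbasis of `H¹(ℂ)` for `E`: `ω φ` spans the eigenspace of the character `φ`,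
for each `φ ∈ Hom(E, ℂ)`. -/
def IsEigenbasis (f : Isogeny Λ (cmLattice Φ)) (ω : (E →+* ℂ) → H1 V) : Prop :=
  ∀ φ : E →+* ℂ, ω φ ≠ 0 ∧ ∀ e : E, pullback (cmAct f e) (ω φ) = φ e • ω φ

/-- The torus `E^× = Res_{E/ℚ} 𝔾_m` in `GL(H¹)`, complex points: the image of `(E ⊗ ℂ)^×`, that is,
the units of the complex algebra generated by the action of `E`. -/
def torusE (f : Isogeny Λ (cmLattice Φ)) : Subgroup (GLH1 V) where
  carrier := {g |
    (g : H1 V →ₗ[ℂ] H1 V) ∈ Algebra.adjoin ℂ (Set.range fun e => pullback (cmAct f e)) ∧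
    ((g⁻¹ : GLH1 V) : H1 V →ₗ[ℂ] H1 V) ∈
      Algebra.adjoin ℂ (Set.range fun e => pullback (cmAct f e))}
  one_mem' := by
    rw [Set.mem_ofPred_eq, inv_one]
    exact ⟨Subalgebra.one_mem _, Subalgebra.one_mem _⟩
  mul_mem' := by
    rintro s t ⟨hs, hs'⟩ ⟨ht, ht'⟩
    rw [Set.mem_ofPred_eq, mul_inv_rev]
    exact ⟨Subalgebra.mul_mem _ hs ht, Subalgebra.mul_mem _ ht' hs'⟩
  inv_mem' := by
    rintro t ⟨ht, ht'⟩
    rw [Set.mem_ofPred_eq, inv_inv]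
    exact ⟨ht', ht⟩

/-- `T = E^× ∩ GSp(H¹, ψ)`. -/
def torusT (f : Isogeny Λ (cmLattice Φ)) (ψ : LinearMap.BilinForm ℂ (H1 V)) :
    Subgroup (GLH1 V) :=
  torusE f ⊓ GSp ψ

/-- `α = ∑_{φ ∈ Φ} a_φ φ + a₀ ε₀` as characters of `T` (written additively), where `φ` is the
character by which `T` acts on the line spanned by `ω φ` and `ε₀` is the similitude character. -/
def HasCoords (f : Isogeny Λ (cmLattice Φ)) (ψ : LinearMap.BilinForm ℂ (H1 V))
    (ω : (E →+* ℂ) → H1 V) (α : torusT f ψ →* ℂˣ) (a : Φ → ℤ) (a₀ : ℤ) : Prop :=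
  ∀ (t : torusT f ψ) (c : ℂˣ) (χ : Φ → ℂˣ), IsSimilitude ψ (t : GLH1 V) c →
    (∀ φ : Φ, (t : GLH1 V) (ω φ) = (χ φ : ℂ) • ω φ) →
      α t = (∏ φ, χ φ ^ a φ) * c ^ a₀

end CMPair

section Wedges

variable {E : Type*} [CommRing E]

/-- The set `Φ^{⊔ n} ∪ Φ̄^{⊔ n}`: `n` copies of `Hom(E, ℂ)`; `(φ, ℓ)` is written `φ^{(ℓ)}`. -/
abbrev EmbCopies (E : Type*) [CommRing E] (n : ℕ) : Type _ := (E →+* ℂ) × Fin n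

variable {V : Type*} [AddCommGroup V] [Module ℂ V] {n : ℕ}

/-- The class `φ^{(ℓ)} ∈ H¹(Aⁿ, ℂ)`: the pull-back of `ω φ` under the `ℓ`-th projection. -/
def copyClass (ω : (E →+* ℂ) → H1 V) (s : EmbCopies E n) : H1 (Fin n → V) :=
  ω s.1 ∘ₗ LinearMap.proj s.2

/-- `[P]`: the wedge product of the classes in `P`, in increasing order. -/
def wedgeOf [LinearOrder (EmbCopies E n)] (ω : (E →+* ℂ) → H1 V) (P : Finset (EmbCopies E n)) :
    Coh (Fin n → V) :=
  ((P.sort (· ≤ ·)).map fun s => ExteriorAlgebra.ι ℂ (copyClass ω s)).prod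

/-- `P` is one of the sets `P_α` assigned to `α = ∑ a_φ φ`: for `a_φ > 0` it contains exactly `a_φ`
of the `φ^{(ℓ)}` and no conjugate of one, for `a_φ < 0` exactly `|a_φ|` of the conjugates of the
`φ^{(ℓ)}` and none of the `φ^{(ℓ)}`, and for `a_φ = 0` neither. -/
def IsAssigned {Φ : Finset (E →+* ℂ)} (a : Φ → ℤ) (P : Finset (EmbCopies E n)) : Prop :=
  ∀ φ : Φ, {ℓ : Fin n | ((φ : E →+* ℂ), ℓ) ∈ P}.ncard = (a φ).toNat ∧
    {ℓ : Fin n | (conjHom (φ : E →+* ℂ), ℓ) ∈ P}.ncard = (-a φ).toNat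

/-- The sets `P_α`, for all `α ∈ N ∩ X^*(T)_n` and all choices of `P_α`. -/
def kernelSets {Λ : Submodule ℤ V} {Φ : Finset (E →+* ℂ)} (f : Isogeny Λ (cmLattice Φ))
    (ψ : LinearMap.BilinForm ℂ (H1 V)) (ω : (E →+* ℂ) → H1 V) (n : ℕ) :
    Set (Finset (EmbCopies E n)) :=
  {P | ∃ α ∈ kernelN Λ (torusT f ψ), ∃ (a : Φ → ℤ) (a₀ : ℤ),
    HasCoords f ψ ω α a a₀ ∧ (∀ φ, |a φ| ≤ n) ∧ IsAssigned a P}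

/-- The list `φ₁^{(ℓ₁)}, φ̄₁^{(ℓ₁')}, …, φ_r^{(ℓ_r)}, φ̄_r^{(ℓ_r')}`. -/
def pairList {Φ : Finset (E →+* ℂ)} (L : List (Φ × Fin n × Fin n)) : List (EmbCopies E n) :=
  L.flatMap fun x => [((x.1 : E →+* ℂ), x.2.1), (conjHom (x.1 : E →+* ℂ), x.2.2)]

/-- The product of the classes `φ_i^{(ℓ_i)} ∧ φ̄_i^{(ℓ_i')}`. -/
def pairProd {Φ : Finset (E →+* ℂ)} (ω : (E →+* ℂ) → H1 V) (L : List (Φ × Fin n × Fin n)) :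
    Coh (Fin n → V) :=
  (L.map fun x => ExteriorAlgebra.ι ℂ (copyClass ω ((x.1 : E →+* ℂ), x.2.1)) *
    ExteriorAlgebra.ι ℂ (copyClass ω (conjHom (x.1 : E →+* ℂ), x.2.2))).prod

/-- `Q` is the disjoint union of `P` and of the pairs in `L`, all of whose members are distinct. -/
def IsPairExtension {Φ : Finset (E →+* ℂ)} (P : Finset (EmbCopies E n))
    (L : List (Φ × Fin n × Fin n)) (Q : Finset (EmbCopies E n)) : Prop :=
  Q.val = P.val + (pairList L : Multiset (EmbCopies E n))

end Wedges

end CMHodge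

end

/-! Call a set Q of copies of embeddings balanced if, for every automorphism σ of ℂ, σQ has as many
members in Φ as outside it. The theorem splits into two facts: B ⊗ ℂ is spanned by the [Q] with Q
balanced, and Q is admissible exactly when it is balanced. Up to scalars the [Q] are the
exterior-algebra basis attached to an eigenbasis, so they are linearly independent and the basis
statement follows.

Hodge side. On Λ the normalised eigenform of φ takes values φ(e) with e ∈ E, so the semilinear
action of σ through the rational structure carries the form of φ to that of σφ (`galH1_eigenForm`)
and [Q] to ±[σQ] (`exists_galCoh`). Rational classes are fixed. Hence if [Q] occurs in a class of
B^p, so does [σQ], which must be of type (p,p): Q is balanced (`hodgeRingC_le_span`). Conversely,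
[Q] is defined over a Galois number field L; for Q balanced its twisted traces over Gal(L/ℚ) are
rational of type (p,p), and independence of characters recovers [Q] from them
(`wedgeOf_mem_hodgeRingC`).

Character side. Let ε be 1 on Φ and −1 off it. By Zariski density of the points (z, conj z), the
Mumford-Tate group contains the conjugates of the cocharacter acting by u on Φ and u⁻¹ off Φ. These
have multiplier 1, so every element of N satisfies ∑ a_φ ε(σφ) = 0 for all σ, whatever a₀ is
(`sum_embSign_of_mem_kernelN`). Conversely, such exponents cut out a group over ℚ containing the
image of the Hodge structure, hence the Mumford-Tate group, and so give a character in N with a₀ = 0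
(`exists_mem_kernelN`).

The two sides meet because conjugation on ℂ comes from an involution of E, hence commutes with σ on
embeddings. A conjugate pair then contributes 0 to every balance sum, and removing pairs from Q
leaves a P_α whose a_φ is the number of copies of φ minus that of its conjugate
(`exists_kernelSets_iff_isBalanced`). -/

open scoped ComplexConjugate

set_option linter.unusedSectionVars false

noncomputable section

namespace CMHodge

/-! ### Independence of characters, exterior algebras, Zariski density -/

section Algebra

/-- Distinct characters can be separated by linear combinations of evaluations. -/
lemma exists_finsupp_sum_monoidHom {M R : Type*} [Monoid M] [Finite R] {χ : R → M →* ℂ}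
    (hχ : Function.Injective χ) (d : R → ℂ) :
    ∃ c : M →₀ ℂ, ∀ r, c.sum (fun m a => a * χ r m) = d r := by
  classical
  have := Fintype.ofFinite R
  -- A functional vanishing on all evaluation vectors is a linear relation between the distinct
  -- characters, which Dedekind's theorem excludes.
  have htop : Submodule.span ℂ (Set.range fun m : M => fun r => χ r m) = ⊤ := by
    by_contra hne
    obtain ⟨g, hg, hle⟩ := Submodule.exists_le_ker_of_lt_top _ (lt_top_iff_ne_top.2 hne)
    apply hg
    have hli := (linearIndependent_monoidHom M ℂ).comp χ hχ
    have hz := Fintype.linearIndependent_iff.1 hli (fun r => g (Pi.single r 1)) (by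
      ext m
      have hm : g (fun r => χ r m) = 0 := hle (Submodule.subset_span ⟨m, rfl⟩)
      rw [← Finset.univ_sum_single (fun r => χ r m), map_sum] at hm
      rw [Finset.sum_apply, Pi.zero_apply, ← hm]
      refine Finset.sum_congr rfl fun r _ => ?_
      have : Pi.single r (χ r m) = χ r m • (Pi.single r 1 : R → ℂ) := by
        ext s; by_cases h : s = r <;> simp [h]
      rw [this, map_smul]
      simp [mul_comm])
    refine LinearMap.pi_ext' fun r => LinearMap.ext_ring ?_
    simpa using hz r
  have hd : d ∈ Submodule.span ℂ (Set.range fun m : M => fun r => χ r m) := htop ▸ trivial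
  obtain ⟨c, hc⟩ := (Finsupp.mem_span_range_iff_exists_finsupp).1 hd
  refine ⟨c, fun r => ?_⟩
  rw [← hc, Finsupp.sum, Finsupp.sum, Finset.sum_apply]
  rfl

/-- A semilinear map whose values square to zero extends to the exterior algebra. -/
lemma exists_semilinear_lift {M A : Type*} [AddCommGroup M] [Module ℂ M] [Ring A] (g : ℂ →+* A)
    (hg : ∀ c x, g c * x = x * g c) (F : M →+ A) (hF : ∀ c m, F (c • m) = g c * F m)
    (hF0 : ∀ m, F m * F m = 0) :
    ∃ Θ : ExteriorAlgebra ℂ M →+* A, (∀ m, Θ (ExteriorAlgebra.ι ℂ m) = F m) ∧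
      ∀ c, Θ (algebraMap ℂ _ c) = g c := by
  -- With scalars acting on `A` through `g`, the semilinear `F` becomes linear and the universal
  -- property applies.
  let := g.toAlgebra' hg
  let F' : M →ₗ[ℂ] A :=
    { toFun := F
      map_add' := F.map_add
      map_smul' := fun c m => (hF c m).trans (Algebra.smul_def c (F m)).symm }
  refine ⟨(ExteriorAlgebra.lift ℂ ⟨F', hF0⟩ : ExteriorAlgebra ℂ M →ₐ[ℂ] A), fun m => ?_,
    fun c => ?_⟩
  · exact ExteriorAlgebra.lift_ι_apply ℂ F' hF0 m
  · exact AlgHom.commutes _ c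

lemma prod_ι_perm {M : Type*} [AddCommGroup M] [Module ℂ M] {l₁ l₂ : List M} (h : l₁.Perm l₂) :
    (l₁.map (ExteriorAlgebra.ι ℂ)).prod = (l₂.map (ExteriorAlgebra.ι ℂ)).prod ∨
      (l₁.map (ExteriorAlgebra.ι ℂ)).prod = -(l₂.map (ExteriorAlgebra.ι ℂ)).prod := by
  induction h with
  | nil => simp
  | cons x _ ih => rcases ih with h | h <;> simp [h]
  | swap x y l =>
    right
    have := eq_neg_of_add_eq_zero_left (ExteriorAlgebra.ι_add_mul_swap y x (R := ℂ))
    simp [← mul_assoc, this]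
  | trans _ _ ih₁ ih₂ =>
    rcases ih₁ with h₁ | h₁ <;> rcases ih₂ with h₂ | h₂ <;> simp [h₁, h₂]

lemma exteriorAlgebra_basis_eq_prod {M I : Type*} [AddCommGroup M] [Module ℂ M] [LinearOrder I]
    (b : Module.Basis I ℂ M) (Q : Finset I) :
    b.ExteriorAlgebra Q = ((Q.sort (· ≤ ·)).map fun s => ExteriorAlgebra.ι ℂ (b s)).prod := by
  rw [ExteriorAlgebra.basis_apply_ofCard b (rfl : Q.card = Q.card), ExteriorAlgebra.ιMulti_family,
    ExteriorAlgebra.ιMulti_apply]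
  congr 1
  refine List.ext_getElem (by simp) fun i h1 h2 => ?_
  simp [Set.powersetCard.ofFinEmbEquiv, Finset.orderEmbOfFin_apply]

/-- Complex polynomials in two variables that vanish at all `(z, conj z)`, `z ≠ 0`, are zero. -/
lemma mvPolynomial_eq_zero_of_conj {p : MvPolynomial (Fin 2) ℂ}
    (hp : ∀ z : ℂˣ, MvPolynomial.eval ![(z : ℂ), conj (z : ℂ)] p = 0) : p = 0 := by
  -- Passing to real and imaginary parts turns the points (z, conj z) into real points of the plane.
  let q : MvPolynomial (Fin 2) ℂ := MvPolynomial.bind₁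
    ![MvPolynomial.X 0 + MvPolynomial.C Complex.I * MvPolynomial.X 1,
      MvPolynomial.X 0 - MvPolynomial.C Complex.I * MvPolynomial.X 1] p
  have hev : ∀ x : Fin 2 → ℂ, MvPolynomial.eval x q =
      MvPolynomial.eval ![x 0 + Complex.I * x 1, x 0 - Complex.I * x 1] p := by
    intro x
    simp only [q, MvPolynomial.eval, MvPolynomial.eval₂Hom_bind₁]
    congr 2
    ext i
    fin_cases i <;> simp
  have hq : q = 0 := by
    -- Positive reals already form an infinite set in each variable, and they guarantee u + iv ≠ 0.
    refine MvPolynomial.funext_set (fun _ => ((↑) : ℝ → ℂ) '' Set.Ioi 0)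
      (fun _ => (Set.Ioi_infinite 0).image Complex.ofReal_injective.injOn) fun x hx => ?_
    obtain ⟨u, hu, hux⟩ := hx 0 trivial
    obtain ⟨v, hv, hvx⟩ := hx 1 trivial
    have hne : (u : ℂ) + Complex.I * v ≠ 0 := by
      intro h
      have := congrArg Complex.re h
      simp at this
      exact (ne_of_gt hu) this
    rw [hev, map_zero, ← hp (Units.mk0 _ hne)]
    simp only [← hux, ← hvx, Units.val_mk0, map_add, map_mul, Complex.conj_I, Complex.conj_ofReal,
      neg_mul, ← sub_eq_add_neg]
  refine MvPolynomial.funext fun x => ?_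
  have := hev ![(x 0 + x 1) / 2, (x 0 - x 1) / (2 * Complex.I)]
  rw [hq, map_zero] at this
  rw [map_zero, this]
  congr 2
  ext i
  have hI := Complex.I_ne_zero
  fin_cases i <;> simp <;> field_simp <;> ring

end Algebra

/-! ### Galois descent for polynomials -/

section Galois

/-- Automorphisms of a subfield of `ℂ` extend to `ℂ`. -/
lemma exists_ringEquiv_extending {L : Type*} [Field L] [Algebra L ℂ] (τ : L ≃+* L) :
    ∃ σ : ℂ ≃+* ℂ, ∀ l : L, σ (algebraMap L ℂ l) = algebraMap L ℂ (τ l) := by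
  obtain ⟨s, hs⟩ := exists_isTranscendenceBasis L ℂ
  have : IsAlgClosure (Algebra.adjoin L (Set.range ((↑) : s → ℂ))) ℂ :=
    IsAlgClosed.isAlgClosure_of_transcendence_basis _ hs
  -- τ acts on coefficients and fixes the transcendence basis; ℂ is an algebraic closure of the
  -- resulting ring, so this automorphism extends.
  let e : Algebra.adjoin L (Set.range ((↑) : s → ℂ)) ≃+*
      Algebra.adjoin L (Set.range ((↑) : s → ℂ)) :=
    (hs.1.aevalEquiv.symm.toRingEquiv.trans (MvPolynomial.mapEquiv _ τ)).trans
      hs.1.aevalEquiv.toRingEquiv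
  refine ⟨IsAlgClosure.equivOfEquiv ℂ ℂ e, fun l => ?_⟩
  have h := IsAlgClosure.equivOfEquiv_algebraMap ℂ ℂ e (algebraMap L _ l)
  have he : e (algebraMap L _ l) = algebraMap L _ (τ l) := by
    have h1 : hs.1.aevalEquiv.symm (algebraMap L _ l) = MvPolynomial.C l :=
      AlgEquiv.commutes _ l
    have h2 : hs.1.aevalEquiv (MvPolynomial.C (τ l)) = algebraMap L _ (τ l) :=
      AlgEquiv.commutes _ (τ l)
    simp only [e, RingEquiv.trans_apply, AlgEquiv.coe_ringEquiv, h1,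
      MvPolynomial.mapEquiv_apply, MvPolynomial.map_C]
    exact h2
  rw [he] at h
  exact h

/-- The values of all complex embeddings of a finite `ℚ`-algebra lie in one Galois number field. -/
lemma exists_galois_subfield (E : Type*) [CommRing E] [Algebra ℚ E] [Module.Finite ℚ E] :
    ∃ L : IntermediateField ℚ ℂ, FiniteDimensional ℚ L ∧ IsGalois ℚ L ∧
      ∀ (φ : E →+* ℂ) (e : E), φ e ∈ L := by
  classical
  let B := Module.Free.chooseBasis ℚ E
  -- An embedding sends each basis vector to a root of its minimal polynomial, so the splitting
  -- field of the product contains all values.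
  let p : Polynomial ℚ := ∏ j, minpoly ℚ (B j)
  have hint : ∀ j, IsIntegral ℚ (B j) := fun j => Algebra.IsIntegral.isIntegral _
  have hp0 : p ≠ 0 := Finset.prod_ne_zero_iff.2 fun j _ => minpoly.ne_zero (hint j)
  have hspl : (p.map (algebraMap ℚ ℂ)).Splits := IsAlgClosed.splits _
  let L := IntermediateField.adjoin ℚ (p.rootSet ℂ)
  have hs : p.IsSplittingField ℚ L := IntermediateField.adjoin_rootSet_isSplittingField hspl
  have hfd : FiniteDimensional ℚ L := Polynomial.IsSplittingField.finiteDimensional L p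
  have hn : Normal ℚ L := Normal.of_isSplittingField p
  refine ⟨L, hfd, ⟨⟩, fun φ e => ?_⟩
  have hB : ∀ j, φ (B j) ∈ L := fun j => by
    apply IntermediateField.subset_adjoin
    rw [Polynomial.mem_rootSet]
    refine ⟨hp0, ?_⟩
    have h1 : Polynomial.aeval (φ.toRatAlgHom (B j)) (minpoly ℚ (B j)) = 0 := by
      rw [Polynomial.aeval_algHom_apply, minpoly.aeval, map_zero]
    have h2 : minpoly ℚ (B j) ∣ p := Finset.dvd_prod_of_mem _ (Finset.mem_univ j)
    obtain ⟨q, hq⟩ := h2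
    rw [hq, map_mul]
    exact mul_eq_zero_of_left h1 _
  have he : φ e = ∑ j, (B.repr e j : ℂ) * φ (B j) := by
    conv_lhs => rw [← B.sum_repr e, ← RingHom.toRatAlgHom_apply φ, map_sum]
    refine Finset.sum_congr rfl fun j _ => ?_
    rw [map_smul, Rat.smul_def, RingHom.toRatAlgHom_apply]
  rw [he]
  exact sum_mem fun j _ => mul_mem (by simp) (hB j)

variable (L : IntermediateField ℚ ℂ) [FiniteDimensional ℚ L] [IsGalois ℚ L]

open Classical in
/-- Over a Galois number field, `δ_{τ, τ₀}` is a combination of the functions `τ ↦ τ l`. -/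
lemma exists_finsupp_sum_galois (τ₀ : L ≃ₐ[ℚ] L) :
    ∃ c : L →₀ ℂ, ∀ τ : L ≃ₐ[ℚ] L, c.sum (fun l a => a * (τ l : ℂ)) = if τ = τ₀ then 1 else 0 := by
  refine exists_finsupp_sum_monoidHom
    (χ := fun τ : L ≃ₐ[ℚ] L => ((L.val.comp (τ : L →ₐ[ℚ] L) : L →ₐ[ℚ] ℂ) : L →* ℂ)) ?_ _
  intro τ τ' h
  ext l
  exact DFunLike.congr_fun h l

lemma ratCast_trace (l : L) :
    ((Algebra.trace ℚ L l : ℚ) : ℂ) = ∑ τ : L ≃ₐ[ℚ] L, (τ l : ℂ) := by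
  have := congrArg (algebraMap L ℂ) (trace_eq_sum_automorphisms (K := ℚ) l)
  rw [map_sum, ← IsScalarTower.algebraMap_apply] at this
  simpa using this

/-- The conjugate by `τ` of a polynomial with coefficients in `L`, evaluated at a complex point. -/
def conjEval {W : Type*} (τ : L ≃ₐ[ℚ] L) (x : W → ℂ) : MvPolynomial W L →+* ℂ :=
  MvPolynomial.eval₂Hom ((algebraMap L ℂ).comp (τ : L →+* L)) x

/-- Take the trace of l·P coefficient by coefficient. -/
lemma exists_rat_polynomial {W : Type*} (P : MvPolynomial W L) (l : L) :
    ∃ p : MvPolynomial W ℚ, ∀ x : W → ℂ,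
      MvPolynomial.aeval x p = ∑ τ : L ≃ₐ[ℚ] L, (τ l : ℂ) * conjEval L τ x P := by
  induction P using MvPolynomial.induction_on' with
  | monomial m c =>
    refine ⟨MvPolynomial.monomial m (Algebra.trace ℚ L (l * c)), fun x => ?_⟩
    rw [MvPolynomial.aeval_monomial]
    simp only [conjEval, MvPolynomial.coe_eval₂Hom, MvPolynomial.eval₂_monomial]
    simp only [← mul_assoc, ← Finset.sum_mul, eq_ratCast, ratCast_trace]
    simp
  | add P P' h h' =>
    obtain ⟨p, hp⟩ := h
    obtain ⟨p', hp'⟩ := h'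
    refine ⟨p + p', fun x => ?_⟩
    simp [hp, hp', mul_add, Finset.sum_add_distrib]

/-- A Galois stable zero locus of polynomials over `L` is a zero locus of rational polynomials. -/
lemma exists_rat_polynomials {W X : Type*} (x : X → W → ℂ) (S : Set (MvPolynomial W L)) :
    ∃ S' : Set (MvPolynomial W ℚ), ∀ g : X,
      (∀ P ∈ S, ∀ τ : L ≃ₐ[ℚ] L, conjEval L τ (x g) P = 0) ↔
        ∀ p ∈ S', MvPolynomial.aeval (x g) p = 0 := by
  classical
  choose p hp using exists_rat_polynomial L (W := W)
  refine ⟨{q | ∃ P ∈ S, ∃ l, q = p P l}, fun g => ⟨?_, fun h P hP τ₀ => ?_⟩⟩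
  · rintro h _ ⟨P, hP, l, rfl⟩
    rw [hp]
    exact Finset.sum_eq_zero fun τ _ => by rw [h P hP τ, mul_zero]
  -- A combination of the traces for varying l isolates the conjugate by τ₀.
  · obtain ⟨c, hc⟩ := exists_finsupp_sum_galois L τ₀
    have h0 : c.sum (fun l a => a * ∑ τ : L ≃ₐ[ℚ] L, (τ l : ℂ) * conjEval L τ (x g) P) = 0 :=
      Finset.sum_eq_zero fun l _ => by
        dsimp only
        rw [← hp, h _ ⟨P, hP, l, rfl⟩, mul_zero]
    have h1 : c.sum (fun l a => a * ∑ τ : L ≃ₐ[ℚ] L, (τ l : ℂ) * conjEval L τ (x g) P) =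
        ∑ τ : L ≃ₐ[ℚ] L, c.sum (fun l a => a * (τ l : ℂ)) * conjEval L τ (x g) P := by
      simp only [Finsupp.sum, Finset.mul_sum, Finset.sum_mul]
      rw [Finset.sum_comm]
      simp only [mul_assoc]
    simp only [h1, hc, ite_mul, one_mul, zero_mul, Finset.sum_ite_eq', Finset.mem_univ,
      if_true] at h0
    exact h0

end Galois

/-! ### The rational structure on H¹ and its semilinear automorphisms -/

section Lattice

variable {V : Type*} [NormedAddCommGroup V] [NormedSpace ℂ V] [FiniteDimensional ℂ V]
  (Λ : Submodule ℤ V) [DiscreteTopology Λ] [IsZLattice ℝ Λ]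

variable {Λ} in
lemma H1_ext {v w : H1 V} (h : ∀ x ∈ Λ, v x = w x) : v = w :=
  LinearMap.ext_on (IsZLattice.span_top (K := ℝ) (L := Λ)) h

/-- A real basis of `V` that is an integral basis of `Λ`. -/
def latticeBasis : Module.Basis (Module.Free.ChooseBasisIndex ℤ Λ) ℝ V :=
  (Module.Free.chooseBasis ℤ Λ).ofZLatticeBasis ℝ Λ

lemma latticeBasis_apply (i : Module.Free.ChooseBasisIndex ℤ Λ) :
    latticeBasis Λ i = (Module.Free.chooseBasis ℤ Λ i : V) :=
  Module.Basis.ofZLatticeBasis_apply _ _ _ _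

lemma latticeBasis_mem (i : Module.Free.ChooseBasisIndex ℤ Λ) : latticeBasis Λ i ∈ Λ := by
  rw [latticeBasis_apply]
  exact (Module.Free.chooseBasis ℤ Λ i).2

variable {Λ} in
lemma exists_int_sum_latticeBasis {x : V} (hx : x ∈ Λ) :
    ∃ m : Module.Free.ChooseBasisIndex ℤ Λ → ℤ, x = ∑ i, m i • latticeBasis Λ i := by
  refine ⟨fun i => (Module.Free.chooseBasis ℤ Λ).repr ⟨x, hx⟩ i, ?_⟩
  have := congrArg (Submodule.subtype Λ) ((Module.Free.chooseBasis ℤ Λ).sum_repr ⟨x, hx⟩)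
  rw [map_sum] at this
  simpa [latticeBasis_apply] using this.symm

/-- The action of a field automorphism `σ` of `ℂ` on `H¹(ℂ) = H¹(ℚ) ⊗ ℂ` through the second
factor. -/
def galH1 (σ : ℂ ≃+* ℂ) : H1 V →+ H1 V where
  toFun v := (latticeBasis Λ).constr ℝ fun i => σ (v (latticeBasis Λ i))
  map_zero' := (latticeBasis Λ).ext fun i => by simp
  map_add' v w := (latticeBasis Λ).ext fun i => by
    simp only [LinearMap.add_apply, Module.Basis.constr_basis, map_add]

variable {Λ}

/-- Additivity of σ carries the defining formula from the basis to integral combinations. Membership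
in Λ matters: σ need not be ℝ-linear. -/
lemma galH1_apply (σ : ℂ ≃+* ℂ) (v : H1 V) {x : V} (hx : x ∈ Λ) : galH1 Λ σ v x = σ (v x) := by
  obtain ⟨m, rfl⟩ := exists_int_sum_latticeBasis hx
  simp only [map_sum, map_zsmul]
  refine Finset.sum_congr rfl fun i _ => ?_
  congr 1
  exact Module.Basis.constr_basis _ _ _ _

lemma galH1_smul (σ : ℂ ≃+* ℂ) (c : ℂ) (v : H1 V) : galH1 Λ σ (c • v) = σ c • galH1 Λ σ v :=
  H1_ext (Λ := Λ) fun x hx => by simp [galH1_apply σ _ hx]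

lemma galH1_of_mem_ratH1 (σ : ℂ ≃+* ℂ) {v : H1 V} (hv : v ∈ ratH1 Λ) : galH1 Λ σ v = v :=
  H1_ext (Λ := Λ) fun x hx => by
    obtain ⟨q, hq⟩ := hv x hx
    rw [galH1_apply σ _ hx, hq, map_ratCast]

variable (Λ) in
/-- The rational forms dual to the lattice basis. -/
def latticeForm (i : Module.Free.ChooseBasisIndex ℤ Λ) : H1 V :=
  Complex.ofRealCLM.toLinearMap ∘ₗ (latticeBasis Λ).coord i

lemma latticeForm_mem (i : Module.Free.ChooseBasisIndex ℤ Λ) : latticeForm Λ i ∈ ratH1 Λ := by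
  intro x hx
  obtain ⟨m, rfl⟩ := exists_int_sum_latticeBasis hx
  refine ⟨m i, ?_⟩
  classical
  simp [latticeForm, Finsupp.single_apply, apply_ite Complex.ofReal]

lemma eq_sum_latticeForm (v : H1 V) : v = ∑ i, v (latticeBasis Λ i) • latticeForm Λ i := by
  classical
  refine (latticeBasis Λ).ext fun j => ?_
  simp [latticeForm, Finsupp.single_apply, apply_ite Complex.ofReal]

end Lattice

/-! ### Separating the Hodge types in H¹ -/

section HodgeType

variable {V : Type*} [AddCommGroup V] [Module ℂ V]

variable (V) in
/-- The endomorphism of `H¹` that is `c` on `H^{1,0}` and `d` on `H^{0,1}`. -/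
def typeScale (c d : ℂ) : H1 V →ₗ[ℂ] H1 V :=
  -- Pull-back by i is i on H^{1,0} and −i on H^{0,1}, so the two brackets are twice the projectors.
  -- Independent c and d will separate p from q.
  (c / 2) • (LinearMap.id - Complex.I • pullback (Complex.I • LinearMap.id)) +
    (d / 2) • (LinearMap.id + Complex.I • pullback (Complex.I • LinearMap.id))

lemma typeScale_of_mem_H10 (c d : ℂ) {v : H1 V} (hv : v ∈ H10 V) : typeScale V c d v = c • v := by
  have h : pullback (Complex.I • LinearMap.id) v = Complex.I • v := by
    ext x
    exact hv Complex.I x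
  simp only [typeScale, LinearMap.add_apply, LinearMap.smul_apply, LinearMap.sub_apply, h,
    LinearMap.id_apply, smul_smul, Complex.I_mul_I]
  module

lemma typeScale_of_mem_H01 (c d : ℂ) {v : H1 V} (hv : v ∈ H01 V) : typeScale V c d v = d • v := by
  have h : pullback (Complex.I • LinearMap.id) v = -Complex.I • v := by
    ext x
    exact (hv Complex.I x).trans (by rw [Complex.conj_I]; rfl)
  simp only [typeScale, LinearMap.add_apply, LinearMap.smul_apply, LinearMap.sub_apply, h,
    LinearMap.id_apply, smul_smul, mul_neg, Complex.I_mul_I]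
  module

lemma hodgeAct_of_mem_H10 (z : ℂˣ) {v : H1 V} (hv : v ∈ H10 V) :
    hodgeAct z v = (z : ℂ) • v := by
  ext x
  exact hv z x

lemma hodgeAct_of_mem_H01 (z : ℂˣ) {v : H1 V} (hv : v ∈ H01 V) :
    hodgeAct z v = conj (z : ℂ) • v := by
  ext x
  exact hv z x

end HodgeType

/-! ### Simultaneous eigenvectors -/

section Eigenvectors

variable {E H : Type*} [CommRing E] [AddCommGroup H] [Module ℂ H] [Finite (E →+* ℂ)]

/-- Every diagonal operator in a family of simultaneous eigenvectors is a combination of the given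
operators. -/
lemma exists_diagonal_operator (T : E → H →ₗ[ℂ] H) (d : (E →+* ℂ) → ℂ) :
    ∃ D ∈ Submodule.span ℂ (Set.range T), ∀ (φ : E →+* ℂ) (v : H),
      (∀ e, T e v = φ e • v) → D v = d φ • v := by
  obtain ⟨c, hc⟩ := exists_finsupp_sum_monoidHom (χ := fun φ : E →+* ℂ => (φ : E →* ℂ))
    (fun φ φ' h => RingHom.ext fun e => DFunLike.congr_fun h e) d
  refine ⟨c.sum fun e a => a • T e, Submodule.sum_mem _ fun e _ =>
    Submodule.smul_mem _ _ (Submodule.subset_span ⟨e, rfl⟩), fun φ v hv => ?_⟩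
  rw [← hc φ, Finsupp.sum, Finsupp.sum, LinearMap.sum_apply, Finset.sum_smul]
  refine Finset.sum_congr rfl fun e _ => ?_
  rw [LinearMap.smul_apply, hv, smul_smul]
  rfl

lemma linearIndependent_of_eigenvectors (T : E → H →ₗ[ℂ] H) (v : (E →+* ℂ) → H)
    (hv0 : ∀ φ, v φ ≠ 0) (hv : ∀ φ e, T e (v φ) = φ e • v φ) : LinearIndependent ℂ v := by
  classical
  have := Fintype.ofFinite (E →+* ℂ)
  refine Fintype.linearIndependent_iff.2 fun g hg φ => ?_
  obtain ⟨D, -, hD⟩ := exists_diagonal_operator T (Pi.single φ 1)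
  have h := congrArg D hg
  simp only [map_sum, map_smul, hD _ _ (hv _), map_zero] at h
  rw [Finset.sum_eq_single φ (fun χ _ hχ => by simp [hχ]) (by simp)] at h
  simpa [hv0 φ] using h

end Eigenvectors

/-! ### The eigenforms of a CM type -/

section CMType

variable {E : Type*} [CommRing E] {Φ : Finset (E →+* ℂ)}

@[simp] lemma conjHom_apply (φ : E →+* ℂ) (e : E) : conjHom φ e = conj (φ e) := rfl

@[simp] lemma conjHom_conjHom (φ : E →+* ℂ) : conjHom (conjHom φ) = φ := by
  ext e
  simp

lemma IsCMType.conjHom_mem (hΦ : IsCMType Φ) {φ : E →+* ℂ} (h : φ ∉ Φ) : conjHom φ ∈ Φ :=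
  not_not.1 fun h' => h ((hΦ φ).2 h')

lemma IsCMType.conjHom_notMem (hΦ : IsCMType Φ) {φ : E →+* ℂ} (h : φ ∈ Φ) : conjHom φ ∉ Φ :=
  (hΦ φ).1 h

lemma IsCMType.finite (hΦ : IsCMType Φ) : Finite (E →+* ℂ) := by
  classical
  refine Set.finite_univ_iff.1 ((Φ ∪ Φ.image conjHom).finite_toSet.subset fun φ _ => ?_)
  by_cases h : φ ∈ Φ
  · simp [h]
  · simp only [Finset.coe_union, Finset.coe_image, Set.mem_union, Set.mem_image, Finset.mem_coe]
    exact Or.inr ⟨_, hΦ.conjHom_mem h, conjHom_conjHom φ⟩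

variable {V : Type*} [AddCommGroup V] [Module ℂ V] {Λ : Submodule ℤ V}

open Classical in
/-- The eigenform of `φ`: a coordinate for `φ ∈ Φ`, the conjugate of one for `conj φ ∈ Φ`. -/
def eigenForm (f : Isogeny Λ (cmLattice Φ)) (φ : E →+* ℂ) : H1 V :=
  if h : φ ∈ Φ then (LinearMap.proj ⟨φ, h⟩ ∘ₗ f.toEquiv.toLinearMap).restrictScalars ℝ
  else if h : conjHom φ ∈ Φ then
    Complex.conjAe.toLinearMap ∘ₗ
      (LinearMap.proj ⟨conjHom φ, h⟩ ∘ₗ f.toEquiv.toLinearMap).restrictScalars ℝ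
  else 0

lemma eigenForm_of_mem (f : Isogeny Λ (cmLattice Φ)) {φ : E →+* ℂ} (h : φ ∈ Φ) (x : V) :
    eigenForm f φ x = f.toEquiv x ⟨φ, h⟩ := by
  simp [eigenForm, h]

lemma eigenForm_of_conjHom_mem (f : Isogeny Λ (cmLattice Φ)) (hΦ : IsCMType Φ) {φ : E →+* ℂ}
    (h : conjHom φ ∈ Φ) (x : V) :
    eigenForm f φ x = conj (f.toEquiv x ⟨conjHom φ, h⟩) := by
  have : φ ∉ Φ := fun h' => (hΦ φ).1 h' h
  simp [eigenForm, h, this]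

variable (f : Isogeny Λ (cmLattice Φ))

lemma eigenForm_mem_H10 {φ : E →+* ℂ} (h : φ ∈ Φ) : eigenForm f φ ∈ H10 V := fun z x => by
  simp [eigenForm_of_mem f h]

lemma eigenForm_mem_H01 (hΦ : IsCMType Φ) {φ : E →+* ℂ} (h : φ ∉ Φ) :
    eigenForm f φ ∈ H01 V := fun z x => by
  simp [eigenForm_of_conjHom_mem f hΦ (hΦ.conjHom_mem h)]

lemma pullback_cmAct_eigenForm (hΦ : IsCMType Φ) (φ : E →+* ℂ) (e : E) :
    pullback (cmAct f e) (eigenForm f φ) = φ e • eigenForm f φ := by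
  ext x
  by_cases h : φ ∈ Φ
  · simp [pullback, eigenForm_of_mem f h, cmAct]
  · simp [pullback, eigenForm_of_conjHom_mem f hΦ (hΦ.conjHom_mem h), cmAct]

/-- The isogeny maps Λ into Φ(𝒪_E), and conjugate coordinates take conjugate values. One e serves
all φ at once, which is the source of Galois equivariance. -/
lemma exists_eigenForm_eq (hΦ : IsCMType Φ) {x : V} (hx : x ∈ Λ) :
    ∃ e : E, ∀ φ : E →+* ℂ, eigenForm f φ x = φ e := by
  obtain ⟨e, -, he⟩ := f.map_mem x hx
  refine ⟨e, fun φ => ?_⟩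
  by_cases h : φ ∈ Φ
  · rw [eigenForm_of_mem f h, he]
  · rw [eigenForm_of_conjHom_mem f hΦ (hΦ.conjHom_mem h), he]
    simp

lemma eigenForm_ne_zero (hΦ : IsCMType Φ) (φ : E →+* ℂ) : eigenForm f φ ≠ 0 := by
  intro h0
  have hx := LinearMap.congr_fun h0 (f.toEquiv.symm fun _ => 1)
  by_cases h : φ ∈ Φ
  · simp [eigenForm_of_mem f h] at hx
  · simp [eigenForm_of_conjHom_mem f hΦ (hΦ.conjHom_mem h)] at hx

lemma span_eigenForm (hΦ : IsCMType Φ) : ⊤ ≤ Submodule.span ℂ (Set.range (eigenForm f)) := by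
  classical
  rintro v -
  let y (φ : Φ) (u : ℂ) : V := f.toEquiv.symm (Pi.single φ u)
  -- In each coordinate, a real-linear g on ℂ is ((g(1) − i g(i))/2) w + ((g(1) + i g(i))/2) conj w.
  have hv : v = ∑ φ : Φ,
      (((v (y φ 1) - Complex.I * v (y φ Complex.I)) / 2) • eigenForm f φ +
      ((v (y φ 1) + Complex.I * v (y φ Complex.I)) / 2) • eigenForm f (conjHom φ)) := by
    ext x
    have hs (r : ℝ) (w : V) : f.toEquiv (r • w) = r • f.toEquiv w :=
      LinearMap.map_smul_of_tower f.toEquiv.toLinearMap r w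
    have hx : x = ∑ φ : Φ, ((f.toEquiv x φ).re • y φ 1 + (f.toEquiv x φ).im • y φ Complex.I) := by
      apply f.toEquiv.injective
      rw [map_sum]
      ext φ
      rw [Finset.sum_apply, Finset.sum_eq_single φ]
      · simp only [map_add, hs, y, LinearEquiv.apply_symm_apply]
        simp [Complex.re_add_im]
      · intro χ _ hχ
        simp only [map_add, hs, y, LinearEquiv.apply_symm_apply]
        simp [hχ.symm]
      · simp
    conv_lhs => rw [hx, map_sum]
    rw [LinearMap.sum_apply]
    refine Finset.sum_congr rfl fun φ _ => ?_
    have h' : conjHom (conjHom (φ : E →+* ℂ)) ∈ Φ := by simp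
    rw [map_add, map_smul, map_smul, LinearMap.add_apply, LinearMap.smul_apply,
      LinearMap.smul_apply, eigenForm_of_mem f φ.2, eigenForm_of_conjHom_mem f hΦ h']
    simp only [conjHom_conjHom, Complex.real_smul, smul_eq_mul, Subtype.coe_eta]
    set c := f.toEquiv x φ
    have h1 : (c.re : ℂ) = (c + conj c) / 2 := by rw [Complex.add_conj]; push_cast; ring
    have h2 : (c.im : ℂ) = -Complex.I * (c - conj c) / 2 := by
      rw [Complex.sub_conj]; push_cast
      linear_combination (c.im : ℂ) * Complex.I_sq
    rw [h1, h2]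
    ring
  rw [hv]
  exact Submodule.sum_mem _ fun φ _ => Submodule.add_mem _
    (Submodule.smul_mem _ _ (Submodule.subset_span ⟨_, rfl⟩))
    (Submodule.smul_mem _ _ (Submodule.subset_span ⟨_, rfl⟩))

/-- The basis of `H¹(ℂ)` formed by the eigenforms. -/
def eigenBasis (hΦ : IsCMType Φ) : Module.Basis (E →+* ℂ) ℂ (H1 V) :=
  haveI := hΦ.finite
  Module.Basis.mk (linearIndependent_of_eigenvectors (fun e => pullback (cmAct f e)) (eigenForm f)
    (eigenForm_ne_zero f hΦ) (pullback_cmAct_eigenForm f hΦ)) (span_eigenForm f hΦ)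

@[simp] lemma eigenBasis_apply (hΦ : IsCMType Φ) (φ : E →+* ℂ) :
    eigenBasis f hΦ φ = eigenForm f φ := by
  simp [eigenBasis]

/-- Eigenvectors are multiples of the eigenforms. -/
lemma IsEigenbasis.exists_smul (hΦ : IsCMType Φ) {ω : (E →+* ℂ) → H1 V} (hω : IsEigenbasis f ω) :
    ∃ c : (E →+* ℂ) → ℂˣ, ∀ φ, ω φ = (c φ : ℂ) • eigenForm f φ := by
  classical
  have := hΦ.finite
  have := Fintype.ofFinite (E →+* ℂ)
  have key : ∀ φ, ω φ = (eigenBasis f hΦ).repr (ω φ) φ • eigenForm f φ := fun φ => by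
    -- `D` projects onto the eigenline of φ and fixes `ω φ`, so the other coordinates of `ω φ`
    -- vanish.
    obtain ⟨D, -, hD⟩ :=
      exists_diagonal_operator (fun e => pullback (cmAct f e)) (Pi.single φ 1)
    have h1 : D (ω φ) = ω φ := by
      rw [hD φ _ (hω φ).2]
      simp
    rw [← h1]
    conv_lhs => rw [← (eigenBasis f hΦ).sum_repr (ω φ), map_sum]
    rw [Finset.sum_eq_single φ]
    · rw [map_smul, eigenBasis_apply, hD φ _ (pullback_cmAct_eigenForm f hΦ φ)]
      simp [h1]
    · intro χ _ hχ
      rw [map_smul, eigenBasis_apply, hD χ _ (pullback_cmAct_eigenForm f hΦ χ)]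
      simp [hχ]
    · simp
  refine ⟨fun φ => Units.mk0 ((eigenBasis f hΦ).repr (ω φ) φ) fun h0 => (hω φ).1 ?_, key⟩
  rw [key, h0, zero_smul]

end CMType

/-! ### Galois action on embeddings and eigenforms -/

section GaloisAction

variable {E : Type*} [CommRing E] {Φ : Finset (E →+* ℂ)}

/-- The action of a field automorphism of `ℂ` on the complex embeddings of `E`. -/
def galHom (σ : ℂ ≃+* ℂ) (φ : E →+* ℂ) : E →+* ℂ := (σ : ℂ →+* ℂ).comp φ

@[simp] lemma galHom_apply (σ : ℂ ≃+* ℂ) (φ : E →+* ℂ) (e : E) : galHom σ φ e = σ (φ e) := rfl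

@[simp] lemma galHom_symm_galHom (σ : ℂ ≃+* ℂ) (φ : E →+* ℂ) :
    galHom σ.symm (galHom σ φ) = φ := by
  ext e
  simp

@[simp] lemma galHom_galHom_symm (σ : ℂ ≃+* ℂ) (φ : E →+* ℂ) :
    galHom σ (galHom σ.symm φ) = φ := by
  ext e
  simp

/-- Complex conjugation on `ℂ` induces an involution of `E` that is independent of the embedding. -/
def HasComplexConj (E : Type*) [CommRing E] : Prop :=
  ∃ c : E → E, ∀ (φ : E →+* ℂ) (e : E), conj (φ e) = φ (c e)

/-- Conjugation can be moved inside φ as the involution of E, where σ does not see it. This is how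
the CM hypothesis enters. -/
lemma HasComplexConj.galHom_conjHom (hE : HasComplexConj E) (σ : ℂ ≃+* ℂ) (φ : E →+* ℂ) :
    galHom σ (conjHom φ) = conjHom (galHom σ φ) := by
  obtain ⟨c, hc⟩ := hE
  ext e
  rw [galHom_apply, conjHom_apply, hc, conjHom_apply, hc, galHom_apply]

lemma hasComplexConj_pi {ι : Type*} [Fintype ι] (K : ι → Type*) [∀ i, Field (K i)]
    [∀ i, NumberField (K i)] [∀ i, NumberField.IsCMField (K i)] : HasComplexConj (∀ i, K i) := by
  classical
  refine ⟨fun e i => NumberField.IsCMField.complexConj (K i) (e i), fun φ e => ?_⟩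
  have hone : (1 : ∀ i, K i) = ∑ i, Pi.single i 1 := (Finset.univ_sum_single 1).symm
  -- The idempotents of the factors sum to 1, and a nonzero idempotent of ℂ is 1; so φ factors
  -- through a single factor.
  obtain ⟨i, hi⟩ : ∃ i, φ (Pi.single i 1) ≠ 0 := by
    by_contra! h
    have := congrArg φ hone
    rw [map_one, map_sum, Finset.sum_eq_zero fun i _ => h i] at this
    exact one_ne_zero this
  have hi1 : φ (Pi.single i 1) = 1 := by
    have : φ (Pi.single i 1) * φ (Pi.single i 1) = φ (Pi.single i 1) := by
      rw [← map_mul, ← Pi.single_mul, one_mul]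
    exact mul_left_cancel₀ hi (this.trans (mul_one _).symm)
  let φi : K i →+* ℂ :=
    { toFun := fun a => φ (Pi.single i a)
      map_one' := hi1
      map_mul' := fun a b => by rw [Pi.single_mul, map_mul]
      map_zero' := by rw [Pi.single_zero, map_zero]
      map_add' := fun a b => by rw [Pi.single_add, map_add] }
  have hφ : ∀ e, φ e = φi (e i) := fun e => by
    have h : e * Pi.single i 1 = Pi.single i (e i) := by
      ext j
      by_cases h : j = i
      · subst h; simp
      · simp [h]
    rw [← mul_one (φ e), ← hi1, ← map_mul, h]
    rfl
  rw [hφ, hφ]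
  exact (NumberField.IsCMField.complexEmbedding_complexConj (K i) φi (e i)).symm

variable {V : Type*} [NormedAddCommGroup V] [NormedSpace ℂ V] [FiniteDimensional ℂ V]
  {Λ : Submodule ℤ V} [DiscreteTopology Λ] [IsZLattice ℝ Λ] (f : Isogeny Λ (cmLattice Φ))

/-- Both forms are determined on Λ, where they take the value σ(φ(e)) for the same e. -/
lemma galH1_eigenForm (hΦ : IsCMType Φ) (σ : ℂ ≃+* ℂ) (φ : E →+* ℂ) :
    galH1 Λ σ (eigenForm f φ) = eigenForm f (galHom σ φ) :=
  H1_ext (Λ := Λ) fun x hx => by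
    obtain ⟨e, he⟩ := exists_eigenForm_eq f hΦ hx
    rw [galH1_apply σ _ hx, he, he, galHom_apply]

/-- A rational form is fixed by the semilinear action, while the eigenforms are permuted, so its
coordinates are permuted along with them. -/
lemma repr_galHom (hΦ : IsCMType Φ) (σ : ℂ ≃+* ℂ) {v : H1 V} (hv : v ∈ ratH1 Λ) (φ : E →+* ℂ) :
    (eigenBasis f hΦ).repr v (galHom σ φ) = σ ((eigenBasis f hΦ).repr v φ) := by
  have := hΦ.finite
  have := Fintype.ofFinite (E →+* ℂ)
  have h : v = ∑ χ, σ ((eigenBasis f hΦ).repr v (galHom σ.symm χ)) • eigenBasis f hΦ χ := by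
    conv_lhs => rw [← galH1_of_mem_ratH1 σ hv, ← (eigenBasis f hΦ).sum_repr v, map_sum]
    refine Fintype.sum_equiv ⟨galHom σ, galHom σ.symm, galHom_symm_galHom σ, galHom_galHom_symm σ⟩
      _ _ fun χ => ?_
    rw [galH1_smul, eigenBasis_apply, galH1_eigenForm f hΦ]
    simp
  conv_lhs => rw [h, Module.Basis.repr_sum_self]
  simp

end GaloisAction

/-! ### Cohomology of the powers of the torus -/

section Powers

variable {V : Type*} [AddCommGroup V] [Module ℂ V] {n : ℕ}

/-- The component of a form on `Vⁿ` in the `ℓ`-th factor. -/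
def component (ℓ : Fin n) : H1 (Fin n → V) →ₗ[ℂ] H1 V where
  toFun v := v ∘ₗ LinearMap.single ℝ (fun _ => V) ℓ
  map_add' _ _ := rfl
  map_smul' _ _ := rfl

@[simp] lemma component_apply (ℓ : Fin n) (v : H1 (Fin n → V)) (x : V) :
    component ℓ v x = v (Pi.single ℓ x) := rfl

/-- The pull-back of a form under the `ℓ`-th projection `Vⁿ → V`. -/
def projPullback (ℓ : Fin n) : H1 V →ₗ[ℂ] H1 (Fin n → V) where
  toFun v := v ∘ₗ LinearMap.proj ℓ
  map_add' _ _ := rfl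
  map_smul' _ _ := rfl

@[simp] lemma projPullback_apply (ℓ : Fin n) (v : H1 V) (x : Fin n → V) :
    projPullback ℓ v x = v (x ℓ) := rfl

lemma sum_projPullback_component (v : H1 (Fin n → V)) :
    ∑ ℓ, projPullback ℓ (component ℓ v) = v := by
  refine LinearMap.ext fun x => ?_
  rw [LinearMap.sum_apply]
  simp only [projPullback_apply, component_apply]
  rw [← map_sum, Finset.univ_sum_single]

lemma component_projPullback (ℓ ℓ' : Fin n) (v : H1 V) :
    component ℓ (projPullback ℓ' v) = if ℓ = ℓ' then v else 0 := by
  ext x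
  by_cases h : ℓ = ℓ'
  · subst h; simp
  · simp [h]

lemma component_mem_ratH1 {Λ : Submodule ℤ V} (ℓ : Fin n) {v : H1 (Fin n → V)}
    (hv : v ∈ ratH1 (powLattice Λ n)) : component ℓ v ∈ ratH1 Λ := fun x hx => by
  refine hv (Pi.single ℓ x) fun k _ => ?_
  by_cases h : k = ℓ
  · subst h; simpa using hx
  · simp [h]

lemma projPullback_mem_ratH1 {Λ : Submodule ℤ V} (ℓ : Fin n) {v : H1 V} (hv : v ∈ ratH1 Λ) :
    projPullback ℓ v ∈ ratH1 (powLattice Λ n) := fun x hx =>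
  hv (x ℓ) (hx ℓ trivial)

variable {E : Type*} [CommRing E]

lemma copyClass_eq_projPullback (ω : (E →+* ℂ) → H1 V) (s : EmbCopies E n) :
    copyClass ω s = projPullback s.2 (ω s.1) := rfl

/-- The basis of `H¹(Vⁿ)` formed by the pull-backs of a basis of `H¹(V)`. -/
def copyBasis (n : ℕ) (b : Module.Basis (E →+* ℂ) ℂ (H1 V)) :
    Module.Basis (EmbCopies E n) ℂ (H1 (Fin n → V)) :=
  Module.Basis.mk (v := copyClass b)
    (by
      rw [linearIndependent_iff']
      intro t g hg s hs
      classical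
      have h := congrArg (component s.2) hg
      simp only [map_sum, map_smul, copyClass_eq_projPullback, component_projPullback,
        map_zero] at h
      have h' := congrArg (fun v => b.repr v s.1) h
      simp only [map_sum, map_smul, Finsupp.coe_finsetSum, Finset.sum_apply, map_zero,
        Finsupp.smul_apply, Finsupp.zero_apply] at h'
      rw [Finset.sum_eq_single s] at h'
      · simpa using h'
      · intro s' _ hne
        by_cases h2 : s.2 = s'.2
        · have h1 : s'.1 ≠ s.1 := fun h1 => hne (Prod.ext h1 h2.symm)
          simp [h2, h1]
        · simp [h2]
      · exact fun h => (h hs).elim)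
    (by
      rintro v -
      rw [← sum_projPullback_component v]
      refine Submodule.sum_mem _ fun ℓ _ => ?_
      have hle : Submodule.map (projPullback ℓ) (Submodule.span ℂ (Set.range b)) ≤
          Submodule.span ℂ (Set.range (copyClass (n := n) b)) := by
        rw [Submodule.map_span, Submodule.span_le]
        rintro _ ⟨_, ⟨φ, rfl⟩, rfl⟩
        exact Submodule.subset_span ⟨(φ, ℓ), rfl⟩
      exact hle ⟨_, by rw [b.span_eq]; trivial, rfl⟩)

@[simp] lemma copyBasis_apply (b : Module.Basis (E →+* ℂ) ℂ (H1 V)) (s : EmbCopies E n) :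
    copyBasis n b s = copyClass b s := by
  simp [copyBasis]

lemma wedgeOf_eq_basis [LinearOrder (EmbCopies E n)] (b : Module.Basis (E →+* ℂ) ℂ (H1 V))
    (Q : Finset (EmbCopies E n)) : wedgeOf b Q = (copyBasis n b).ExteriorAlgebra Q := by
  rw [exteriorAlgebra_basis_eq_prod]
  simp only [copyBasis_apply]
  rfl

lemma wedgeOf_eq_or_eq_neg [LinearOrder (EmbCopies E n)] (ω : (E →+* ℂ) → H1 V)
    (Q : Finset (EmbCopies E n)) {l : List (EmbCopies E n)} (hl : Q.val = (l : Multiset _)) :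
    (l.map fun s => ExteriorAlgebra.ι ℂ (copyClass ω s)).prod = wedgeOf ω Q ∨
      (l.map fun s => ExteriorAlgebra.ι ℂ (copyClass ω s)).prod = -wedgeOf ω Q := by
  have hp : l.Perm (Q.sort (· ≤ ·)) := by
    rw [← Multiset.coe_eq_coe, ← hl, Finset.sort_eq]
  have := prod_ι_perm (hp.map (copyClass ω))
  rw [List.map_map, List.map_map] at this
  exact this

lemma wedgeOf_smul [LinearOrder (EmbCopies E n)] (c : (E →+* ℂ) → ℂˣ) {ω z : (E →+* ℂ) → H1 V}
    (h : ∀ φ, ω φ = (c φ : ℂ) • z φ) (Q : Finset (EmbCopies E n)) :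
    wedgeOf ω Q = (∏ s ∈ Q, c s.1) • wedgeOf z Q := by
  have key : ∀ l : List (EmbCopies E n),
      (l.map fun s => ExteriorAlgebra.ι ℂ (copyClass ω s)).prod =
        (l.map fun s => c s.1).prod •
          (l.map fun s => ExteriorAlgebra.ι ℂ (copyClass z s)).prod := by
    intro l
    induction l with
    | nil => simp
    | cons s l ih =>
      have hs : copyClass ω s = (c s.1 : ℂ) • copyClass z s := by
        rw [copyClass_eq_projPullback, h, map_smul]
        rfl
      rw [List.map_cons, List.prod_cons, ih, hs, map_smul, List.map_cons, List.prod_cons,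
        List.map_cons, List.prod_cons]
      simp only [Units.smul_def, Units.val_mul, smul_mul_smul_comm]
  rw [wedgeOf, key, wedgeOf]
  congr 1
  have := Finset.prod_map_toList Q (fun s => c s.1)
  rw [← this]
  exact ((Q.sort_perm_toList (· ≤ ·)).map _).prod_eq

end Powers

/-! ### Hodge types of the wedge classes -/

section HodgeType

variable {V : Type*} [AddCommGroup V] [Module ℂ V] {n : ℕ} {E : Type*} [CommRing E]

/-- The number of elements of `Q` that are of type `(1,0)`. -/
def holCount (Φ : Finset (E →+* ℂ)) (Q : Finset (EmbCopies E n)) : ℕ :=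
  open Classical in (Q.filter fun s => s.1 ∈ Φ).card

/-- The number of elements of `Q` that are of type `(0,1)`. -/
def antiCount (Φ : Finset (E →+* ℂ)) (Q : Finset (EmbCopies E n)) : ℕ :=
  open Classical in (Q.filter fun s => s.1 ∉ Φ).card

lemma algHom_smul_of_mem_pow {A : Type*} [Ring A] [Algebra ℂ A] (T : A →ₐ[ℂ] A)
    {S : Submodule ℂ A} {c : ℂ} (h : ∀ x ∈ S, T x = c • x) {p : ℕ} {x : A} (hx : x ∈ S ^ p) :
    T x = c ^ p • x := by
  induction hx using Submodule.pow_induction_on_left' with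
  | algebraMap r => simp
  | add x y i _ _ hx hy => rw [map_add, hx, hy, smul_add]
  | mem_mul m hm i x _ hx =>
    rw [map_mul, h m hm, hx, smul_mul_smul_comm, pow_succ']

lemma map_typeScale_of_mem_hodgePart (c d : ℂ) {p q : ℕ} {y : Coh V} (hy : y ∈ hodgePart V p q) :
    ExteriorAlgebra.map (typeScale V c d) y = (c ^ p * d ^ q) • y := by
  induction hy using Submodule.mul_induction_on' with
  | mem_mul_mem a ha b hb =>
    rw [map_mul, algHom_smul_of_mem_pow (c := c) _ _ ha, algHom_smul_of_mem_pow (c := d) _ _ hb,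
      smul_mul_smul_comm]
    · rintro _ ⟨v, hv, rfl⟩
      rw [ExteriorAlgebra.map_apply_ι, typeScale_of_mem_H01 c d hv, map_smul]
    · rintro _ ⟨v, hv, rfl⟩
      rw [ExteriorAlgebra.map_apply_ι, typeScale_of_mem_H10 c d hv, map_smul]
  | add x _ y _ hx hy => rw [map_add, hx, hy, smul_add]

variable {Λ : Submodule ℤ V} {Φ : Finset (E →+* ℂ)} (f : Isogeny Λ (cmLattice Φ))

lemma copyClass_mem_H10 {s : EmbCopies E n} (h : s.1 ∈ Φ) :
    copyClass (eigenForm f) s ∈ H10 (Fin n → V) := fun z x =>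
  eigenForm_mem_H10 f h z (x s.2)

lemma copyClass_mem_H01 (hΦ : IsCMType Φ) {s : EmbCopies E n} (h : s.1 ∉ Φ) :
    copyClass (eigenForm f) s ∈ H01 (Fin n → V) := fun z x =>
  eigenForm_mem_H01 f hΦ h z (x s.2)

variable [LinearOrder (EmbCopies E n)]

lemma map_typeScale_wedgeOf (hΦ : IsCMType Φ) (c d : ℂ) (Q : Finset (EmbCopies E n)) :
    ExteriorAlgebra.map (typeScale (Fin n → V) c d) (wedgeOf (eigenForm f) Q) =
      (c ^ holCount Φ Q * d ^ antiCount Φ Q) • wedgeOf (eigenForm f) Q := by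
  classical
  have key : ∀ l : List (EmbCopies E n),
      ExteriorAlgebra.map (typeScale (Fin n → V) c d)
        (l.map fun s => ExteriorAlgebra.ι ℂ (copyClass (eigenForm f) s)).prod =
        (l.map fun s => if s.1 ∈ Φ then c else d).prod •
          (l.map fun s => ExteriorAlgebra.ι ℂ (copyClass (eigenForm f) s)).prod := by
    intro l
    induction l with
    | nil => simp
    | cons s l ih =>
      simp only [List.map_cons, List.prod_cons, map_mul, ih, ExteriorAlgebra.map_apply_ι]
      by_cases h : s.1 ∈ Φ
      · rw [typeScale_of_mem_H10 c d (copyClass_mem_H10 f h), map_smul, smul_mul_smul_comm,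
          if_pos h]
      · rw [typeScale_of_mem_H01 c d (copyClass_mem_H01 f hΦ h), map_smul, smul_mul_smul_comm,
          if_neg h]
  rw [wedgeOf, key]
  congr 1
  have h1 : ((Q.sort (· ≤ ·)).map fun s => if s.1 ∈ Φ then c else d).prod =
      ∏ s ∈ Q, if s.1 ∈ Φ then c else d := by
    rw [← Finset.prod_map_toList]
    exact ((Q.sort_perm_toList (· ≤ ·)).map _).prod_eq
  rw [h1, Finset.prod_ite, Finset.prod_const, Finset.prod_const]
  rw [holCount, antiCount]

/-- Scaling H^{1,0} by c and H^{0,1} by d is diagonal in the [Q], so a nonzero coefficient forces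
equal scaling factors. The choices (2,1) and (1,2) read off the two exponents. -/
lemma holCount_eq_of_repr_ne_zero [Finite (E →+* ℂ)] (hΦ : IsCMType Φ) {p q : ℕ}
    {y : Coh (Fin n → V)} (hy : y ∈ hodgePart (Fin n → V) p q) {Q : Finset (EmbCopies E n)}
    (hQ : (copyBasis n (eigenBasis f hΦ)).ExteriorAlgebra.repr y Q ≠ 0) :
    holCount Φ Q = p ∧ antiCount Φ Q = q := by
  have := Fintype.ofFinite (E →+* ℂ)
  set b := (copyBasis n (eigenBasis f hΦ)).ExteriorAlgebra with hb
  have hbQ : ∀ Q, b Q = wedgeOf (eigenForm f) Q := fun Q => by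
    rw [hb, ← wedgeOf_eq_basis]
    congr
    ext1 φ
    exact eigenBasis_apply f hΦ φ
  have key : ∀ c d : ℂ, c ^ p * d ^ q = c ^ holCount Φ Q * d ^ antiCount Φ Q := fun c d => by
    have h1 := congrArg (fun w => b.repr w Q) (map_typeScale_of_mem_hodgePart c d hy)
    have h2 : ExteriorAlgebra.map (typeScale (Fin n → V) c d) y =
        ∑ P, (b.repr y P * (c ^ holCount Φ P * d ^ antiCount Φ P)) • b P := by
      conv_lhs => rw [← b.sum_repr y, map_sum]
      refine Finset.sum_congr rfl fun P _ => ?_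
      rw [map_smul, hbQ, map_typeScale_wedgeOf f hΦ, smul_smul]
    simp only [h2, Module.Basis.repr_sum_self, map_smul, Finsupp.smul_apply, smul_eq_mul] at h1
    exact mul_left_cancel₀ hQ (by rw [mul_comm, ← h1])
  have two : ∀ a b : ℕ, (2 : ℂ) ^ a = 2 ^ b → a = b := fun a b h =>
    Nat.pow_right_injective le_rfl (by exact_mod_cast h)
  exact ⟨(two _ _ (by simpa using key 2 1)).symm, (two _ _ (by simpa using key 1 2)).symm⟩

lemma wedgeOf_mem_hodgePart (hΦ : IsCMType Φ) (Q : Finset (EmbCopies E n)) :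
    wedgeOf (eigenForm f) Q ∈ hodgePart (Fin n → V) (holCount Φ Q) (antiCount Φ Q) := by
  classical
  have hmem : ∀ (S : Submodule ℂ (H1 (Fin n → V))) (l : List (EmbCopies E n)),
      (∀ s ∈ l, copyClass (eigenForm f) s ∈ S) →
      (l.map fun s => ExteriorAlgebra.ι ℂ (copyClass (eigenForm f) s)).prod ∈
        (S.map (ExteriorAlgebra.ι ℂ)) ^ l.length := by
    intro S l
    induction l with
    | nil => intro _; simp
    | cons s l ih =>
      intro h
      rw [List.map_cons, List.prod_cons, List.length_cons, pow_succ']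
      exact Submodule.mul_mem_mul ⟨_, h s (by simp), rfl⟩ (ih fun s' hs' => h s' (by simp [hs']))
  let l₁ := (Q.filter fun s => s.1 ∈ Φ).toList
  let l₂ := (Q.filter fun s => s.1 ∉ Φ).toList
  have h₁ := hmem (H10 (Fin n → V)) l₁ fun s hs => copyClass_mem_H10 f (by
    simp only [l₁, Finset.mem_toList, Finset.mem_filter] at hs; exact hs.2)
  have h₂ := hmem (H01 (Fin n → V)) l₂ fun s hs => copyClass_mem_H01 f hΦ (by
    simp only [l₂, Finset.mem_toList, Finset.mem_filter] at hs; exact hs.2)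
  have hl₁ : l₁.length = holCount Φ Q := by
    simp only [l₁, Finset.length_toList, holCount]
  have hl₂ : l₂.length = antiCount Φ Q := by
    simp only [l₂, Finset.length_toList, antiCount]
  rw [hl₁] at h₁
  rw [hl₂] at h₂
  have hprod := Submodule.mul_mem_mul h₁ h₂
  rw [← List.prod_append, ← List.map_append] at hprod
  have hQ : Q.val = ((l₁ ++ l₂ : List _) : Multiset (EmbCopies E n)) := by
    rw [← Multiset.coe_add, Finset.coe_toList, Finset.coe_toList, Finset.filter_val,
      Finset.filter_val, Multiset.filter_add_not]
  rcases wedgeOf_eq_or_eq_neg (eigenForm f) Q hQ with h | h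
  · rw [h] at hprod
    exact hprod
  · rw [h] at hprod
    exact (Submodule.neg_mem_iff _).1 hprod

end HodgeType

/-! ### Balanced sets -/

section Balanced

variable {E : Type*} [CommRing E] {n : ℕ}

/-- The permutation of the copies of `Hom(E, ℂ)` given by a field automorphism of `ℂ`. -/
def galCopies (n : ℕ) (σ : ℂ ≃+* ℂ) : EmbCopies E n ≃ EmbCopies E n :=
  Equiv.prodCongr ⟨galHom σ, galHom σ.symm, galHom_symm_galHom σ, galHom_galHom_symm σ⟩
    (Equiv.refl _)

/-- `1` on `Φ` and `-1` on its complement. -/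
def embSign (Φ : Finset (E →+* ℂ)) (φ : E →+* ℂ) : ℤ :=
  open Classical in if φ ∈ Φ then 1 else -1

/-- The conjugates of `Q` contain as many elements of type `(1,0)` as elements of type `(0,1)`. -/
def IsBalanced (Φ : Finset (E →+* ℂ)) (Q : Finset (EmbCopies E n)) : Prop :=
  ∀ σ : ℂ ≃+* ℂ, ∑ s ∈ Q, embSign Φ (galHom σ s.1) = 0

lemma sum_embSign (Φ : Finset (E →+* ℂ)) (Q : Finset (EmbCopies E n)) :
    ∑ s ∈ Q, embSign Φ s.1 = holCount Φ Q - antiCount Φ Q := by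
  classical
  simp only [embSign, Finset.sum_ite, Finset.sum_const, holCount, antiCount]
  simp [sub_eq_add_neg]

lemma holCount_add_antiCount (Φ : Finset (E →+* ℂ)) (Q : Finset (EmbCopies E n)) :
    holCount Φ Q + antiCount Φ Q = Q.card := by
  classical
  exact Finset.card_filter_add_card_filter_not _

lemma sum_embSign_galHom (Φ : Finset (E →+* ℂ)) (σ : ℂ ≃+* ℂ) (Q : Finset (EmbCopies E n)) :
    ∑ s ∈ Q, embSign Φ (galHom σ s.1) =
      holCount Φ (Q.map (galCopies n σ).toEmbedding) -
        antiCount Φ (Q.map (galCopies n σ).toEmbedding) := by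
  rw [← sum_embSign, Finset.sum_map]
  rfl

/-- Conjugation preserves the cardinality, and balance makes both counts half of it. -/
lemma IsBalanced.holCount_eq {Φ : Finset (E →+* ℂ)} {Q : Finset (EmbCopies E n)}
    (hQ : IsBalanced Φ Q) (σ : ℂ ≃+* ℂ) :
    holCount Φ (Q.map (galCopies n σ).toEmbedding) = holCount Φ Q ∧
      antiCount Φ (Q.map (galCopies n σ).toEmbedding) = holCount Φ Q := by
  have h1 := hQ σ
  rw [sum_embSign_galHom] at h1
  have h2 := hQ (RingEquiv.refl ℂ)
  have h3 := holCount_add_antiCount Φ (Q.map (galCopies n σ).toEmbedding)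
  rw [Finset.card_map] at h3
  have h4 := holCount_add_antiCount Φ Q
  have h5 : ∑ s ∈ Q, embSign Φ s.1 = 0 := h2
  rw [sum_embSign] at h5
  omega

lemma IsBalanced.antiCount_eq {Φ : Finset (E →+* ℂ)} {Q : Finset (EmbCopies E n)}
    (hQ : IsBalanced Φ Q) : antiCount Φ Q = holCount Φ Q := by
  have h5 : ∑ s ∈ Q, embSign Φ s.1 = 0 := hQ (RingEquiv.refl ℂ)
  rw [sum_embSign] at h5
  omega

end Balanced

/-! ### Hodge classes and balanced sets -/

section Descent

variable {E : Type*} [CommRing E] {Φ : Finset (E →+* ℂ)} {n : ℕ}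
variable {V : Type*} [NormedAddCommGroup V] [NormedSpace ℂ V] [FiniteDimensional ℂ V]
  {Λ : Submodule ℤ V} [DiscreteTopology Λ] [IsZLattice ℝ Λ] (f : Isogeny Λ (cmLattice Φ))

variable (Λ n) in
/-- The action of a field automorphism of `ℂ` on `H¹(Vⁿ, ℂ) = H¹(Vⁿ, ℚ) ⊗ ℂ`. -/
def galPow (σ : ℂ ≃+* ℂ) : H1 (Fin n → V) →+ H1 (Fin n → V) :=
  ∑ ℓ, (projPullback ℓ).toAddMonoidHom.comp
    ((galH1 Λ σ).comp (component ℓ).toAddMonoidHom)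

lemma galPow_apply (σ : ℂ ≃+* ℂ) (v : H1 (Fin n → V)) :
    galPow n Λ σ v = ∑ ℓ, projPullback ℓ (galH1 Λ σ (component ℓ v)) := by
  simp [galPow]

lemma galPow_smul (σ : ℂ ≃+* ℂ) (c : ℂ) (v : H1 (Fin n → V)) :
    galPow n Λ σ (c • v) = σ c • galPow n Λ σ v := by
  simp only [galPow_apply, map_smul, galH1_smul, Finset.smul_sum]

lemma galPow_of_mem_ratH1 (σ : ℂ ≃+* ℂ) {v : H1 (Fin n → V)} (hv : v ∈ ratH1 (powLattice Λ n)) :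
    galPow n Λ σ v = v := by
  rw [galPow_apply]
  conv_rhs => rw [← sum_projPullback_component v]
  exact Finset.sum_congr rfl fun ℓ _ => by
    rw [galH1_of_mem_ratH1 σ (component_mem_ratH1 ℓ hv)]

lemma galPow_copyClass (hΦ : IsCMType Φ) (σ : ℂ ≃+* ℂ) (s : EmbCopies E n) :
    galPow n Λ σ (copyClass (eigenForm f) s) = copyClass (eigenForm f) (galCopies n σ s) := by
  rw [galPow_apply, Finset.sum_eq_single s.2]
  · rw [copyClass_eq_projPullback, component_projPullback, if_pos rfl, galH1_eigenForm f hΦ]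
    rfl
  · intro ℓ _ h
    rw [copyClass_eq_projPullback, component_projPullback, if_neg h, map_zero, map_zero]
  · simp

variable [LinearOrder (EmbCopies E n)]

/-- The semilinear action of a field automorphism of `ℂ` on the cohomology. -/
lemma exists_galCoh (hΦ : IsCMType Φ) (σ : ℂ ≃+* ℂ) :
    ∃ Θ : Coh (Fin n → V) →+* Coh (Fin n → V), (∀ (c : ℂ) y, Θ (c • y) = σ c • Θ y) ∧
      (∀ r, ∀ y ∈ ratCoh (powLattice Λ n) r, Θ y = y) ∧
      ∀ Q : Finset (EmbCopies E n),
        Θ (wedgeOf (eigenForm f) Q) =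
            wedgeOf (eigenForm f) (Q.map (galCopies n σ).toEmbedding) ∨
          Θ (wedgeOf (eigenForm f) Q) =
            -wedgeOf (eigenForm f) (Q.map (galCopies n σ).toEmbedding) := by
  obtain ⟨Θ, hι, hc⟩ := exists_semilinear_lift
    ((algebraMap ℂ (Coh (Fin n → V))).comp (σ : ℂ →+* ℂ))
    (fun c x => Algebra.commutes (σ c) x)
    ((ExteriorAlgebra.ι ℂ : H1 (Fin n → V) →ₗ[ℂ] _).toAddMonoidHom.comp (galPow n Λ σ))
    (fun c m => by
      simp only [AddMonoidHom.comp_apply, galPow_smul, LinearMap.toAddMonoidHom_coe, map_smul,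
        Algebra.smul_def]
      rfl)
    (fun m => ExteriorAlgebra.ι_sq_zero _)
  have hsmul : ∀ (c : ℂ) y, Θ (c • y) = σ c • Θ y := fun c y => by
    rw [Algebra.smul_def, map_mul, hc, Algebra.smul_def]
    rfl
  refine ⟨Θ, hsmul, fun r y hy => ?_, fun Q => ?_⟩
  · induction hy using Submodule.pow_induction_on_left' with
    | algebraMap q =>
      rw [IsScalarTower.algebraMap_apply ℚ ℂ, hc]
      simp
    | add x y i _ _ hx hy => rw [map_add, hx, hy]
    | mem_mul m hm i x _ hx =>
      obtain ⟨v, hv, rfl⟩ := hm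
      rw [map_mul, hx]
      congr 1
      refine (hι v).trans ?_
      exact congrArg (ExteriorAlgebra.ι ℂ) (galPow_of_mem_ratH1 σ hv)
  · have h1 : Θ (wedgeOf (eigenForm f) Q) =
        (((Q.sort (· ≤ ·)).map (galCopies n σ)).map fun s =>
          ExteriorAlgebra.ι ℂ (copyClass (eigenForm f) s)).prod := by
      rw [wedgeOf, map_list_prod, List.map_map, List.map_map]
      congr 1
      refine List.map_congr_left fun s _ => ?_
      exact (hι _).trans (congrArg (ExteriorAlgebra.ι ℂ) (galPow_copyClass f hΦ σ s))
    rw [h1]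
    refine wedgeOf_eq_or_eq_neg _ _ ?_
    rw [Finset.map_val, ← Finset.sort_eq Q (· ≤ ·), Multiset.map_coe]
    rfl

lemma wedgeOf_eigenForm (hΦ : IsCMType Φ) (Q : Finset (EmbCopies E n)) :
    wedgeOf (eigenForm f) Q = (copyBasis n (eigenBasis f hΦ)).ExteriorAlgebra Q := by
  rw [← wedgeOf_eq_basis]
  congr
  ext1 φ
  exact (eigenBasis_apply f hΦ φ).symm

/-- Rational Hodge classes are combinations of balanced classes. -/
lemma hodgeRingC_le_span (hΦ : IsCMType Φ) :
    hodgeRingC (powLattice Λ n) ≤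
      Submodule.span ℂ (wedgeOf (eigenForm f) '' {Q : Finset (EmbCopies E n) | IsBalanced Φ Q}) := by
  have := hΦ.finite
  have := Fintype.ofFinite (E →+* ℂ)
  set S := Submodule.span ℂ
    (wedgeOf (eigenForm f) '' {Q : Finset (EmbCopies E n) | IsBalanced Φ Q}) with hS
  suffices h : ∀ p, ∀ y ∈ hodgeClasses (powLattice Λ n) p, y ∈ S by
    refine Submodule.span_le.2 ?_
    have : hodgeRing (powLattice Λ n) ≤ S.restrictScalars ℚ :=
      iSup₂_le fun p _ y hy => h p y hy
    exact this
  rintro p y ⟨hy1, hy2⟩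
  set b := (copyBasis n (eigenBasis f hΦ)).ExteriorAlgebra with hb
  have hbQ : ∀ Q, b Q = wedgeOf (eigenForm f) Q := fun Q => (wedgeOf_eigenForm f hΦ Q).symm
  rw [← b.sum_repr y]
  refine Submodule.sum_mem _ fun Q _ => ?_
  by_cases h0 : b.repr y Q = 0
  · rw [h0, zero_smul]
    exact Submodule.zero_mem _
  refine Submodule.smul_mem _ _ (Submodule.subset_span ⟨Q, fun σ => ?_, (hbQ Q).symm⟩)
  obtain ⟨Θ, hsmul, hrat, hw⟩ := exists_galCoh f hΦ σ (n := n)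
  -- `Θ` fixes y and permutes the basis up to sign, so the coefficient at σQ is ± the image under σ
  -- of the coefficient at Q.
  have hne : b.repr y (Q.map (galCopies n σ).toEmbedding) ≠ 0 := by
    have hsum : y = ∑ P, σ (b.repr y P) • Θ (b P) := by
      conv_lhs => rw [← hrat _ y hy2, ← b.sum_repr y, map_sum]
      simp only [hsmul]
    have hrepr : ∀ P, b.repr (Θ (b P)) (Q.map (galCopies n σ).toEmbedding) =
        if P = Q then b.repr (Θ (b Q)) (Q.map (galCopies n σ).toEmbedding) else 0 := by
      intro P
      split_ifs with h
      · rw [h]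
      · have : P.map (galCopies n σ).toEmbedding ≠ Q.map (galCopies n σ).toEmbedding :=
          fun h' => h (Finset.map_injective _ h')
        rw [hbQ]
        rcases hw P with h' | h' <;> rw [h', ← hbQ] <;> simp [this]
    have hval : b.repr y (Q.map (galCopies n σ).toEmbedding) =
        σ (b.repr y Q) * b.repr (Θ (b Q)) (Q.map (galCopies n σ).toEmbedding) := by
      conv_lhs => rw [hsum]
      simp only [map_sum, map_smul, Finsupp.coe_finsetSum, Finset.sum_apply, Finsupp.smul_apply,
        smul_eq_mul]
      rw [Finset.sum_eq_single Q]
      · intro P _ hP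
        rw [hrepr, if_neg hP, mul_zero]
      · simp
    rw [hval]
    refine mul_ne_zero (by simpa using h0) ?_
    rw [hbQ]
    rcases hw Q with h' | h' <;> rw [h', ← hbQ] <;> simp
  obtain ⟨h1, h2⟩ := holCount_eq_of_repr_ne_zero f hΦ hy1 hne
  rw [sum_embSign_galHom, h1, h2, sub_self]

/-- Combinations, with coefficients in `L`, of rational classes of degree `r`. -/
def fieldCoh (L : IntermediateField ℚ ℂ) (M : Submodule ℤ V) (r : ℕ) : Submodule ℚ (Coh V) :=
  Submodule.span ℚ {y | ∃ l : L, ∃ w ∈ ratCoh M r, y = (l : ℂ) • w}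

lemma mul_mem_fieldCoh {V : Type*} [NormedAddCommGroup V] [NormedSpace ℂ V]
    (L : IntermediateField ℚ ℂ) (M : Submodule ℤ V) {r r' : ℕ} {x y : Coh V}
    (hx : x ∈ fieldCoh L M r) (hy : y ∈ fieldCoh L M r') : x * y ∈ fieldCoh L M (r + r') := by
  have h : fieldCoh L M r * fieldCoh L M r' ≤ fieldCoh L M (r + r') := by
    rw [fieldCoh, fieldCoh, Submodule.span_mul_span, Submodule.span_le]
    rintro _ ⟨_, ⟨l, w, hw, rfl⟩, _, ⟨l', w', hw', rfl⟩, rfl⟩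
    refine Submodule.subset_span ⟨l * l', w * w', ?_, ?_⟩
    · rw [ratCoh, pow_add]
      exact Submodule.mul_mem_mul hw hw'
    · dsimp only
      rw [smul_mul_smul_comm]
      rfl
  exact h (Submodule.mul_mem_mul hx hy)

variable (L : IntermediateField ℚ ℂ)

lemma copyClass_mem_fieldCoh (hΦ : IsCMType Φ) (hL : ∀ (φ : E →+* ℂ) e, φ e ∈ L)
    (s : EmbCopies E n) :
    ExteriorAlgebra.ι ℂ (copyClass (eigenForm f) s) ∈ fieldCoh L (powLattice Λ n) 1 := by
  rw [copyClass_eq_projPullback, eq_sum_latticeForm (Λ := Λ) (eigenForm f s.1), map_sum, map_sum]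
  refine Submodule.sum_mem _ fun i _ => Submodule.subset_span ?_
  obtain ⟨e, he⟩ := exists_eigenForm_eq f hΦ (latticeBasis_mem Λ i)
  refine ⟨⟨s.1 e, hL _ _⟩, ExteriorAlgebra.ι ℂ (projPullback s.2 (latticeForm Λ i)), ?_, ?_⟩
  · rw [ratCoh, pow_one]
    exact ⟨_, projPullback_mem_ratH1 _ (latticeForm_mem i), rfl⟩
  · rw [map_smul, map_smul, he]

lemma wedgeOf_mem_fieldCoh (hΦ : IsCMType Φ) (hL : ∀ (φ : E →+* ℂ) e, φ e ∈ L)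
    (Q : Finset (EmbCopies E n)) :
    wedgeOf (eigenForm f) Q ∈ fieldCoh L (powLattice Λ n) Q.card := by
  have key : ∀ l : List (EmbCopies E n),
      (l.map fun s => ExteriorAlgebra.ι ℂ (copyClass (eigenForm f) s)).prod ∈
        fieldCoh L (powLattice Λ n) l.length := by
    intro l
    induction l with
    | nil =>
      refine Submodule.subset_span ⟨1, 1, ?_, by simp⟩
      rw [ratCoh, List.length_nil, pow_zero]
      exact Submodule.one_le.1 le_rfl
    | cons s l ih =>
      rw [List.map_cons, List.prod_cons, List.length_cons, add_comm]
      exact mul_mem_fieldCoh L _ (copyClass_mem_fieldCoh f L hΦ hL s) ih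
  have := key (Q.sort (· ≤ ·))
  rwa [Finset.length_sort] at this

variable [FiniteDimensional ℚ L] [IsGalois ℚ L]

-- On a generator l'·w with w rational the sum is Tr(l l')·w.
omit [LinearOrder (EmbCopies E n)] in
lemma sum_galois_mem_ratCoh {W : Type*} [NormedAddCommGroup W] [NormedSpace ℂ W]
    {M : Submodule ℤ W} {r : ℕ}
    (σ : (L ≃ₐ[ℚ] L) → (ℂ ≃+* ℂ)) (hσ : ∀ τ (l : L), σ τ l = τ l)
    (Θ : (L ≃ₐ[ℚ] L) → (Coh W →+* Coh W)) (hsmul : ∀ τ (c : ℂ) y, Θ τ (c • y) = σ τ c • Θ τ y)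
    (hrat : ∀ τ, ∀ y ∈ ratCoh M r, Θ τ y = y) {y : Coh W} (hy : y ∈ fieldCoh L M r) (l : L) :
    ∑ τ : L ≃ₐ[ℚ] L, (τ l : ℂ) • Θ τ y ∈ ratCoh M r := by
  induction hy using Submodule.span_induction with
  | mem y hy =>
    obtain ⟨l', w, hw, rfl⟩ := hy
    have : ∑ τ : L ≃ₐ[ℚ] L, (τ l : ℂ) • Θ τ ((l' : ℂ) • w) =
        (Algebra.trace ℚ L (l * l') : ℚ) • w := by
      simp only [hsmul, hrat _ w hw, hσ, smul_smul]
      rw [← Finset.sum_smul, ← Rat.cast_smul_eq_qsmul ℂ, ratCast_trace]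
      simp
    rw [this]
    exact Submodule.smul_mem _ _ hw
  | zero => simp
  | add x y _ _ hx hy =>
    simp only [map_add, smul_add, Finset.sum_add_distrib]
    exact Submodule.add_mem _ hx hy
  | smul q y _ hy =>
    have : ∀ τ, Θ τ (q • y) = q • Θ τ y := fun τ => by
      rw [← Rat.cast_smul_eq_qsmul ℂ, hsmul, map_ratCast, Rat.cast_smul_eq_qsmul]
    simp only [this, smul_comm _ q, ← Finset.smul_sum]
    exact Submodule.smul_mem _ _ hy

/-- Balanced classes are combinations of rational Hodge classes. -/
lemma wedgeOf_mem_hodgeRingC (hΦ : IsCMType Φ) (hL : ∀ (φ : E →+* ℂ) e, φ e ∈ L)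
    {Q : Finset (EmbCopies E n)} (hQ : IsBalanced Φ Q) :
    wedgeOf (eigenForm f) Q ∈ hodgeRingC (powLattice Λ n) := by
  classical
  choose σ hσ using fun τ : L ≃ₐ[ℚ] L => exists_ringEquiv_extending (τ : L ≃+* L)
  choose Θ hsmul hrat hw using fun τ => exists_galCoh (n := n) f hΦ (σ τ)
  set p := holCount Φ Q with hp
  have hcard : Q.card = 2 * p := by
    have h1 := holCount_add_antiCount Φ Q
    have h2 := hQ.antiCount_eq
    omega
  -- Rational as a trace from L, and of type (p,p) because each summand is a multiple of some [σQ].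
  have hclass : ∀ l : L, ∑ τ : L ≃ₐ[ℚ] L, (τ l : ℂ) • Θ τ (wedgeOf (eigenForm f) Q) ∈
      hodgeClasses (powLattice Λ n) p := fun l => by
    refine ⟨Submodule.sum_mem (hodgePart (Fin n → V) p p) fun τ _ =>
      Submodule.smul_mem _ _ ?_, ?_⟩
    · have h := wedgeOf_mem_hodgePart f hΦ (Q.map (galCopies n (σ τ)).toEmbedding)
      rw [(hQ.holCount_eq (σ τ)).1, (hQ.holCount_eq (σ τ)).2] at h
      rcases hw τ Q with h' | h' <;> rw [h']
      · exact h
      · exact Submodule.neg_mem _ h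
    · rw [← hcard]
      exact sum_galois_mem_ratCoh L σ hσ Θ hsmul (fun τ => hrat τ _)
        (wedgeOf_mem_fieldCoh f L hΦ hL Q) l
  -- The Hodge ring stops at the dimension n·|Φ|, which bounds the number of members of Q of type
  -- (1,0).
  have hple : p ∈ Finset.range (Module.finrank ℂ (Fin n → V) + 1) := by
    rw [Finset.mem_range, Nat.lt_succ_iff, Module.finrank_pi_fintype, f.toEquiv.finrank_eq,
      Module.finrank_fintype_fun_eq_card, Finset.sum_const, Finset.card_univ, smul_eq_mul,
      Fintype.card_coe, Fintype.card_fin, mul_comm]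
    have : (Φ ×ˢ (Finset.univ : Finset (Fin n))).card = Φ.card * n := by
      rw [Finset.card_product, Finset.card_univ, Fintype.card_fin]
    rw [← this, hp, holCount]
    refine Finset.card_le_card fun s hs => ?_
    simp only [Finset.mem_filter] at hs
    simp [hs.2]
  have hmem : ∀ l : L, ∑ τ : L ≃ₐ[ℚ] L, (τ l : ℂ) • Θ τ (wedgeOf (eigenForm f) Q) ∈
      hodgeRingC (powLattice Λ n) := fun l =>
    Submodule.subset_span (le_iSup₂_of_le (f := fun p (_ : p ∈ Finset.range _) =>
      hodgeClasses (powLattice Λ n) p) p hple le_rfl (hclass l))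
  -- Independence of the τ extracts the summand for τ = 1 from the traces.
  obtain ⟨c, hc⟩ := exists_finsupp_sum_galois L 1
  have hΘ : Θ 1 (wedgeOf (eigenForm f) Q) ∈ hodgeRingC (powLattice Λ n) := by
    have : Θ 1 (wedgeOf (eigenForm f) Q) = c.sum fun l a =>
        a • ∑ τ : L ≃ₐ[ℚ] L, (τ l : ℂ) • Θ τ (wedgeOf (eigenForm f) Q) := by
      have h1 : (c.sum fun l a =>
          a • ∑ τ : L ≃ₐ[ℚ] L, (τ l : ℂ) • Θ τ (wedgeOf (eigenForm f) Q)) =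
          ∑ τ : L ≃ₐ[ℚ] L, c.sum (fun l a => a * (τ l : ℂ)) •
            Θ τ (wedgeOf (eigenForm f) Q) := by
        simp only [Finsupp.sum, Finset.smul_sum, Finset.sum_smul, smul_smul]
        rw [Finset.sum_comm]
      rw [h1]
      simp only [hc]
      simp
    rw [this]
    exact Submodule.sum_mem _ fun l _ => Submodule.smul_mem _ _ (hmem l)
  -- `σ 1` is merely some automorphism of ℂ trivial on L. It still fixes every embedding, so `Θ 1`
  -- changes [Q] at most by a sign.
  have hone : Q.map (galCopies n (σ 1)).toEmbedding = Q := by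
    have : (galCopies n (σ 1) : EmbCopies E n ≃ EmbCopies E n) = Equiv.refl _ := by
      ext1 s
      refine Prod.ext (RingHom.ext fun e => ?_) rfl
      exact hσ 1 ⟨s.1 e, hL _ _⟩
    rw [this]
    exact Finset.map_refl
  rcases hw 1 Q with h | h <;> rw [hone] at h <;> rw [h] at hΘ
  · exact hΘ
  · exact (Submodule.neg_mem_iff _).1 hΘ

end Descent

/-! ### Diagonal automorphisms -/

section Diagonal

variable {H R : Type*} [AddCommGroup H] [Module ℂ H]

/-- The automorphism that is diagonal in the given basis. -/
def diagEquiv (b : Module.Basis R ℂ H) (χ : R → ℂˣ) : H ≃ₗ[ℂ] H :=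
  b.equiv (b.unitsSMul χ) (Equiv.refl R)

@[simp] lemma diagEquiv_basis (b : Module.Basis R ℂ H) (χ : R → ℂˣ) (r : R) :
    diagEquiv b χ (b r) = (χ r : ℂ) • b r := by
  simp [diagEquiv, Module.Basis.unitsSMul_apply, Units.smul_def]

lemma diagEquiv_inv (b : Module.Basis R ℂ H) (χ : R → ℂˣ) :
    (diagEquiv b χ)⁻¹ = diagEquiv b χ⁻¹ := by
  rw [inv_eq_iff_mul_eq_one]
  refine LinearEquiv.toLinearMap_injective (b.ext fun r => ?_)
  change diagEquiv b χ (diagEquiv b χ⁻¹ (b r)) = b r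
  simp [smul_smul]

end Diagonal

/-! ### Cocharacters in the Mumford-Tate group -/

section MumfordTate

variable {E : Type*} [CommRing E] {Φ : Finset (E →+* ℂ)}
variable {V : Type*} [NormedAddCommGroup V] [NormedSpace ℂ V] [FiniteDimensional ℂ V]
  {Λ : Submodule ℤ V} [DiscreteTopology Λ] [IsZLattice ℝ Λ] (f : Isogeny Λ (cmLattice Φ))

/-- The conjugates of the Hodge cocharacter: `u` on the `φ` with `σφ ∈ Φ`, `u⁻¹` on the others. -/
def conjCochar (f : Isogeny Λ (cmLattice Φ)) (hΦ : IsCMType Φ) (σ : ℂ ≃+* ℂ) (u : ℂˣ) : GLH1 V :=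
  diagEquiv (eigenBasis f hΦ) fun φ => u ^ embSign Φ (galHom σ φ)

lemma conjCochar_eigenForm (hΦ : IsCMType Φ) (σ : ℂ ≃+* ℂ) (u : ℂˣ) (φ : E →+* ℂ) :
    conjCochar f hΦ σ u (eigenForm f φ) =
      ((u ^ embSign Φ (galHom σ φ) : ℂˣ) : ℂ) • eigenForm f φ := by
  rw [← eigenBasis_apply f hΦ, conjCochar, diagEquiv_basis]

lemma coeff_of_diagonal [Fintype (E →+* ℂ)] (hΦ : IsCMType Φ) {g : GLH1 V} {c : (E →+* ℂ) → ℂ}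
    (hg : ∀ φ, g (eigenForm f φ) = c φ • eigenForm f φ) (i : ratH1 Λ × Λ) :
    coeff Λ g i = ∑ φ, (eigenBasis f hΦ).repr (i.1 : H1 V) φ * eigenForm f φ (i.2 : V) * c φ := by
  rw [coeff]
  conv_lhs => rw [← (eigenBasis f hΦ).sum_repr (i.1 : H1 V), map_sum]
  rw [LinearMap.sum_apply]
  refine Finset.sum_congr rfl fun φ _ => ?_
  rw [eigenBasis_apply, map_smul, hg]
  simp only [LinearMap.smul_apply, smul_eq_mul]
  ring

lemma hodgeAct_eigenForm (hΦ : IsCMType Φ) (z : ℂˣ) (φ : E →+* ℂ) [Decidable (φ ∈ Φ)] :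
    hodgeAct z (eigenForm f φ) =
      (if φ ∈ Φ then (z : ℂ) else conj (z : ℂ)) • eigenForm f φ := by
  split_ifs with h
  · exact hodgeAct_of_mem_H10 z (eigenForm_mem_H10 f h)
  · exact hodgeAct_of_mem_H01 z (eigenForm_mem_H01 f hΦ h)

/-- The Mumford-Tate group contains the conjugates of the Hodge cocharacter. -/
lemma conjCochar_mem_mumfordTate (hΦ : IsCMType Φ) (σ : ℂ ≃+* ℂ) (u : ℂˣ) :
    conjCochar f hΦ σ u ∈ mumfordTate Λ := by
  classical
  have := hΦ.finite
  have := Fintype.ofFinite (E →+* ℂ)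
  rw [mumfordTate, Subgroup.mem_sInf]
  rintro G ⟨⟨S, hS⟩, hG⟩
  rw [hS]
  intro p hp
  -- The matrix coefficients of the Hodge structure are A z + B conj z. Replacing z and conj z by
  -- independent variables in p gives `P`, which vanishes by density.
  let m (φ : E →+* ℂ) (i : ratH1 Λ × Λ) : ℂ :=
    (eigenBasis f hΦ).repr (i.1 : H1 V) φ * eigenForm f φ (i.2 : V)
  let A (i : ratH1 Λ × Λ) : ℂ := ∑ φ, if φ ∈ Φ then m φ i else 0
  let B (i : ratH1 Λ × Λ) : ℂ := ∑ φ, if φ ∈ Φ then 0 else m φ i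
  let P : MvPolynomial (Fin 2) ℂ := MvPolynomial.aeval (fun i =>
    MvPolynomial.C (A i) * MvPolynomial.X 0 + MvPolynomial.C (B i) * MvPolynomial.X 1) p
  have hP : ∀ x : Fin 2 → ℂ, MvPolynomial.eval x P =
      MvPolynomial.aeval (fun i => A i * x 0 + B i * x 1) p := fun x => by
    have := MvPolynomial.comp_aeval_apply (fun i =>
      (MvPolynomial.C (A i) * MvPolynomial.X 0 + MvPolynomial.C (B i) * MvPolynomial.X 1 :
        MvPolynomial (Fin 2) ℂ)) (MvPolynomial.eval x).toRatAlgHom p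
    simpa [P] using this
  have hP0 : P = 0 := by
    refine mvPolynomial_eq_zero_of_conj fun z => ?_
    have h := (hS _).1 (hG z) p hp
    have hc : coeff Λ (hodgeAct z) = fun i => A i * z + B i * conj (z : ℂ) := by
      ext i
      rw [coeff_of_diagonal f hΦ (fun φ => hodgeAct_eigenForm f hΦ z φ), Finset.sum_mul,
        Finset.sum_mul, ← Finset.sum_add_distrib]
      refine Finset.sum_congr rfl fun φ _ => ?_
      by_cases h : φ ∈ Φ <;> simp [h, m]
    rw [hc] at h
    rw [hP]
    exact h
  -- The coefficients of the conjugate cocharacter are σ⁻¹ of those at the point (σu, σu⁻¹). As p is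
  -- rational, σ⁻¹ passes through it.
  have hc : coeff Λ (conjCochar f hΦ σ u) =
      fun i => σ.symm (A i * σ (u : ℂ) + B i * σ ((u⁻¹ : ℂˣ) : ℂ)) := by
    ext i
    rw [coeff_of_diagonal f hΦ (conjCochar_eigenForm f hΦ σ u), ← σ.injective.eq_iff,
      RingEquiv.apply_symm_apply, map_sum, Finset.sum_mul, Finset.sum_mul,
      ← Finset.sum_add_distrib]
    refine Fintype.sum_equiv ⟨galHom σ, galHom σ.symm, galHom_symm_galHom σ, galHom_galHom_symm σ⟩
      _ _ fun φ => ?_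
    have h1 := repr_galHom f hΦ σ i.1.2 φ
    have h2 : eigenForm f (galHom σ φ) (i.2 : V) = σ (eigenForm f φ (i.2 : V)) := by
      rw [← galH1_eigenForm f hΦ, galH1_apply σ _ i.2.2]
    simp only [Equiv.coe_fn_mk, m, h1, h2, embSign]
    by_cases h : galHom σ φ ∈ Φ <;> simp [h]
  have := MvPolynomial.comp_aeval_apply (fun i => A i * σ (u : ℂ) + B i * σ ((u⁻¹ : ℂˣ) : ℂ))
    (σ.symm : ℂ →+* ℂ).toRatAlgHom p
  rw [hc]
  refine this.symm.trans ?_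
  have h0 := hP ![σ (u : ℂ), σ ((u⁻¹ : ℂˣ) : ℂ)]
  rw [hP0, map_zero] at h0
  simp only [Matrix.cons_val_zero, Matrix.cons_val_one] at h0
  rw [← h0, map_zero]

lemma diagEquiv_mem_torusE (hΦ : IsCMType Φ) (χ : (E →+* ℂ) → ℂˣ) :
    diagEquiv (eigenBasis f hΦ) χ ∈ torusE f := by
  have := hΦ.finite
  have key : ∀ χ : (E →+* ℂ) → ℂˣ,
      (diagEquiv (eigenBasis f hΦ) χ : H1 V →ₗ[ℂ] H1 V) ∈
        Algebra.adjoin ℂ (Set.range fun e => pullback (cmAct f e)) := fun χ => by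
    obtain ⟨D, hD, hDv⟩ :=
      exists_diagonal_operator (fun e => pullback (cmAct f e)) fun φ => (χ φ : ℂ)
    have : (diagEquiv (eigenBasis f hΦ) χ : H1 V →ₗ[ℂ] H1 V) = D := by
      refine (eigenBasis f hΦ).ext fun φ => ?_
      rw [LinearEquiv.coe_coe, diagEquiv_basis, eigenBasis_apply,
        hDv φ _ (pullback_cmAct_eigenForm f hΦ φ)]
    rw [this]
    exact Algebra.span_le_adjoin ℂ _ hD
  refine ⟨key χ, ?_⟩
  rw [diagEquiv_inv]
  exact key _

variable {ψ : LinearMap.BilinForm ℂ (H1 V)}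

lemma IsPolarization.galH1 (hψ : IsPolarization Λ ψ) (σ : ℂ ≃+* ℂ) (x y : H1 V) :
    ψ (galH1 Λ σ x) (galH1 Λ σ y) = σ (ψ x y) := by
  rw [eq_sum_latticeForm (Λ := Λ) x, eq_sum_latticeForm (Λ := Λ) y]
  simp only [map_sum, galH1_smul, galH1_of_mem_ratH1 σ (latticeForm_mem _), map_smul,
    LinearMap.sum_apply, LinearMap.smul_apply, smul_eq_mul, map_mul]
  refine Finset.sum_congr rfl fun i _ => ?_
  congr 1
  refine Finset.sum_congr rfl fun j _ => ?_
  obtain ⟨q, hq⟩ := hψ.rational _ (latticeForm_mem j) _ (latticeForm_mem i)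
  rw [hq, map_ratCast]

/-- Rationality of ψ moves the claim to σφ and σφ', so σ = 1 suffices. At z = i the multiplier is 1,
whereas two eigenforms of the same type would contribute i² or (−i)², which is −1. -/
lemma IsPolarization.embSign_add_eq_zero (hψ : IsPolarization Λ ψ) (hΦ : IsCMType Φ)
    {φ φ' : E →+* ℂ} (h : ψ (eigenForm f φ) (eigenForm f φ') ≠ 0) (σ : ℂ ≃+* ℂ) :
    embSign Φ (galHom σ φ) + embSign Φ (galHom σ φ') = 0 := by
  classical
  have key : ∀ φ φ' : E →+* ℂ, ψ (eigenForm f φ) (eigenForm f φ') ≠ 0 →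
      embSign Φ φ + embSign Φ φ' = 0 := by
    intro φ φ' h
    have h1 := hψ.hodge (Units.mk0 Complex.I Complex.I_ne_zero) (eigenForm f φ) (eigenForm f φ')
    rw [hodgeAct_eigenForm f hΦ, hodgeAct_eigenForm f hΦ, map_smul, map_smul,
      LinearMap.smul_apply, smul_eq_mul, smul_eq_mul, ← mul_assoc] at h1
    have h2 := mul_right_cancel₀ h h1
    by_cases hφ : φ ∈ Φ <;> by_cases hφ' : φ' ∈ Φ <;>
      simp [hφ, hφ', embSign] at h2 ⊢ <;> norm_num at h2
  refine key _ _ ?_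
  rw [← galH1_eigenForm f hΦ, ← galH1_eigenForm f hΦ, hψ.galH1]
  simpa using h

/-- Eigenforms that pair nontrivially under ψ carry opposite exponents of u. Multiplier 1 makes the
ε₀-coordinate of a character invisible on these elements. -/
lemma conjCochar_isSimilitude (hψ : IsPolarization Λ ψ) (hΦ : IsCMType Φ) (σ : ℂ ≃+* ℂ)
    (u : ℂˣ) : IsSimilitude ψ (conjCochar f hΦ σ u) 1 := by
  have h : ψ.compl₁₂ (conjCochar f hΦ σ u : H1 V →ₗ[ℂ] H1 V)
      (conjCochar f hΦ σ u : H1 V →ₗ[ℂ] H1 V) = ψ := by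
    refine (eigenBasis f hΦ).ext fun φ => (eigenBasis f hΦ).ext fun φ' => ?_
    simp only [LinearMap.compl₁₂_apply, LinearEquiv.coe_coe, eigenBasis_apply,
      conjCochar_eigenForm, map_smul, LinearMap.smul_apply, smul_eq_mul, ← mul_assoc]
    by_cases h0 : ψ (eigenForm f φ) (eigenForm f φ') = 0
    · rw [h0, mul_zero]
    · rw [← Units.val_mul, ← zpow_add, add_comm, hψ.embSign_add_eq_zero f hΦ h0, zpow_zero,
        Units.val_one, one_mul]
  intro x y
  rw [Units.val_one, one_mul]
  exact LinearMap.congr_fun (LinearMap.congr_fun h x) y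

lemma conjCochar_mem_torusT (hψ : IsPolarization Λ ψ) (hΦ : IsCMType Φ) (σ : ℂ ≃+* ℂ) (u : ℂˣ) :
    conjCochar f hΦ σ u ∈ torusT f ψ :=
  ⟨diagEquiv_mem_torusE f hΦ _, 1, conjCochar_isSimilitude f hψ hΦ σ u⟩

lemma prod_zpow_eq_zpow_sum {ι : Type*} (s : Finset ι) (u : ℂˣ) (a : ι → ℤ) :
    ∏ i ∈ s, u ^ a i = u ^ ∑ i ∈ s, a i :=
  (map_sum (zpowersHom ℂˣ u).toAdditiveRight a s).symm

/-- Characters of `T` that are trivial on the Mumford-Tate group have balanced coordinates. -/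
lemma sum_embSign_of_mem_kernelN (hψ : IsPolarization Λ ψ) (hΦ : IsCMType Φ)
    {ω : (E →+* ℂ) → H1 V} (hω : IsEigenbasis f ω) {α : torusT f ψ →* ℂˣ}
    (hα : α ∈ kernelN Λ (torusT f ψ)) {a : Φ → ℤ} {a₀ : ℤ} (ha : HasCoords f ψ ω α a a₀)
    (σ : ℂ ≃+* ℂ) : ∑ φ, a φ * embSign Φ (galHom σ φ) = 0 := by
  obtain ⟨c, hc⟩ := hω.exists_smul f hΦ
  -- Any u of infinite order would do: its power is 1 only for exponent 0.
  let u : ℂˣ := Units.mk0 2 two_ne_zero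
  have h1 := hα.2 ⟨_, conjCochar_mem_torusT f hψ hΦ σ u⟩ (conjCochar_mem_mumfordTate f hΦ σ u)
  rw [ha _ 1 (fun φ => u ^ embSign Φ (galHom σ φ)) (conjCochar_isSimilitude f hψ hΦ σ u)
    (fun φ => by
      rw [hc, map_smul]
      change _ • conjCochar f hΦ σ u (eigenForm f φ) = _
      rw [conjCochar_eigenForm, smul_comm]), one_zpow, mul_one] at h1
  simp only [← zpow_mul] at h1
  rw [prod_zpow_eq_zpow_sum] at h1
  have h2 : (2 : ℝ) ^ (∑ φ : Φ, embSign Φ (galHom σ φ) * a φ) = 2 ^ (0 : ℤ) := by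
    have := congrArg (fun x : ℂˣ => ‖(x : ℂ)‖) h1
    simpa [u] using this
  have h3 := zpow_right_injective₀ (by norm_num : (0 : ℝ) < 2) (by norm_num) h2
  simpa only [mul_comm] using h3

end MumfordTate

/-! ### Characters trivial on the Mumford-Tate group -/

section Characters

variable {E : Type*} [CommRing E] {Φ : Finset (E →+* ℂ)}
variable {V : Type*} [NormedAddCommGroup V] [NormedSpace ℂ V] [FiniteDimensional ℂ V]
  {Λ : Submodule ℤ V} [DiscreteTopology Λ] [IsZLattice ℝ Λ] (f : Isogeny Λ (cmLattice Φ))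

lemma galHom_eq_self {L : IntermediateField ℚ ℂ} (hL : ∀ (φ : E →+* ℂ) e, φ e ∈ L)
    {σ : ℂ ≃+* ℂ} (hσ : ∀ l : L, σ l = l) (φ : E →+* ℂ) : galHom σ φ = φ :=
  RingHom.ext fun e => hσ ⟨φ e, hL φ e⟩

lemma eigenForm_mem_field {L : IntermediateField ℚ ℂ} (hL : ∀ (φ : E →+* ℂ) e, φ e ∈ L)
    (hΦ : IsCMType Φ) (φ : E →+* ℂ) (x : Λ) : eigenForm f φ x ∈ L := by
  obtain ⟨e, he⟩ := exists_eigenForm_eq f hΦ x.2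
  rw [he]
  exact hL φ e

lemma eigenForm_galHom_apply (hΦ : IsCMType Φ) (σ : ℂ ≃+* ℂ) (φ : E →+* ℂ) (x : Λ) :
    eigenForm f (galHom σ φ) x = σ (eigenForm f φ x) := by
  rw [← galH1_eigenForm f hΦ, galH1_apply σ _ x.2]

lemma exists_eigenForm_apply_ne_zero (hΦ : IsCMType Φ) (φ : E →+* ℂ) :
    ∃ x : Λ, eigenForm f φ x ≠ 0 := by
  by_contra! h
  exact eigenForm_ne_zero f hΦ φ (H1_ext (Λ := Λ) fun x hx => h ⟨x, hx⟩)

/-- `g ↦ l • (g φ)(x)` is a linear polynomial over `L` in the matrix coefficients of `g`, and its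
conjugates are of the same form. -/
lemma exists_polynomial_eval_eigenForm (hΦ : IsCMType Φ) (L : IntermediateField ℚ ℂ)
    (hL : ∀ (φ : E →+* ℂ) e, φ e ∈ L) (φ : E →+* ℂ) (l : L) (x : Λ) :
    ∃ P : MvPolynomial (ratH1 Λ × Λ) L, ∀ (τ : L ≃ₐ[ℚ] L) (σ : ℂ ≃+* ℂ),
      (∀ l : L, σ l = τ l) → ∀ g : GLH1 V,
        conjEval L τ (coeff Λ g) P = σ l * g (eigenForm f (galHom σ φ)) x := by
  let y (i : Module.Free.ChooseBasisIndex ℤ Λ) : Λ := ⟨latticeBasis Λ i, latticeBasis_mem Λ i⟩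
  -- The coordinates of an eigenform in the rational basis are its values on the lattice basis. They
  -- lie in L, and conjugating them replaces φ by σφ.
  refine ⟨∑ i, MvPolynomial.C (l * ⟨eigenForm f φ (y i), eigenForm_mem_field f hL hΦ φ _⟩) *
    MvPolynomial.X (⟨latticeForm Λ i, latticeForm_mem i⟩, x), fun τ σ hσ g => ?_⟩
  conv_rhs => rw [eq_sum_latticeForm (Λ := Λ) (eigenForm f (galHom σ φ))]
  simp only [map_sum, map_smul, LinearMap.sum_apply, LinearMap.smul_apply, map_mul,
    Finset.mul_sum, smul_eq_mul]
  refine Finset.sum_congr rfl fun i _ => ?_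
  rw [show latticeBasis Λ i = (y i : V) from rfl, eigenForm_galHom_apply f hΦ]
  simp only [conjEval, MvPolynomial.coe_eval₂Hom, MvPolynomial.eval₂_C, MvPolynomial.eval₂_X,
    coeff, RingHom.comp_apply]
  have h1 : algebraMap L ℂ (τ l) = σ l := (hσ l).symm
  have h2 : ∀ m : L, algebraMap L ℂ (τ m) = σ m := fun m => (hσ m).symm
  erw [h2, h2]
  ring

lemma units_zpow_eq (u : ℂˣ) (a : ℤ) : u ^ a = u ^ a.toNat * u⁻¹ ^ (-a).toNat := by
  rw [← zpow_natCast, ← zpow_natCast, inv_zpow, ← zpow_neg, ← zpow_add]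
  congr 1
  omega

/-- The elements of `GL(H¹)` that are diagonal in the eigenforms and satisfy the multiplicative
relations `∏ χ_{τφ}^{a_φ} = 1`. -/
def relationSubgroup {G : Type*} (σ : G → (ℂ ≃+* ℂ)) (a : Φ → ℤ) : Subgroup (GLH1 V) where
  carrier := {g | ∃ χ : (E →+* ℂ) → ℂˣ, (∀ φ, g (eigenForm f φ) = (χ φ : ℂ) • eigenForm f φ) ∧
    ∀ τ, ∏ φ : Φ, χ (galHom (σ τ) φ) ^ a φ = 1}
  one_mem' := ⟨1, fun φ => by simp, fun τ => by simp⟩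
  mul_mem' := by
    rintro g g' ⟨χ, h1, h2⟩ ⟨χ', h1', h2'⟩
    refine ⟨χ * χ', fun φ => ?_, fun τ => ?_⟩
    · rw [LinearEquiv.mul_apply, h1', map_smul, h1, smul_smul, mul_comm]
      rfl
    · simp only [Pi.mul_apply, mul_zpow, Finset.prod_mul_distrib, h2, h2', one_mul]
  inv_mem' := by
    rintro g ⟨χ, h1, h2⟩
    refine ⟨χ⁻¹, fun φ => ?_, fun τ => ?_⟩
    · apply g.injective
      change g (g.symm _) = _
      rw [g.apply_symm_apply, map_smul, h1, smul_smul]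
      simp
    · simp only [Pi.inv_apply, inv_zpow, Finset.prod_inv_distrib, h2, inv_one]

/-- The conditions are polynomial over L, and imposing them for every τ makes the locus Galois
stable, so `exists_rat_polynomials` descends it to ℚ. -/
lemma relationSubgroup_isAlgebraicOverQ (hΦ : IsCMType Φ) (L : IntermediateField ℚ ℂ)
    [FiniteDimensional ℚ L] [IsGalois ℚ L] (hL : ∀ (φ : E →+* ℂ) e, φ e ∈ L)
    (σ : (L ≃ₐ[ℚ] L) → (ℂ ≃+* ℂ)) (hσ : ∀ τ (l : L), σ τ l = τ l) (a : Φ → ℤ) :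
    IsAlgebraicOverQ Λ (relationSubgroup f σ a) := by
  choose P hP using exists_polynomial_eval_eigenForm f hΦ L hL
  choose x hx using exists_eigenForm_apply_ne_zero f hΦ
  let y (i : Module.Free.ChooseBasisIndex ℤ Λ) : Λ := ⟨latticeBasis Λ i, latticeBasis_mem Λ i⟩
  let z (φ : E →+* ℂ) (x : Λ) : L := ⟨eigenForm f φ x, eigenForm_mem_field f hL hΦ φ x⟩
  have hz : ∀ τ φ x, σ τ (z φ x) = eigenForm f (galHom (σ τ) φ) x := fun τ φ x =>
    (eigenForm_galHom_apply f hΦ _ _ _).symm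
  -- `C φ` reads the eigenvalue at a lattice point where the eigenform is nonzero. `D φ i` tests at
  -- a lattice basis vector whether g multiplies the eigenform by it.
  let C (φ : E →+* ℂ) : MvPolynomial (ratH1 Λ × Λ) L := P φ (z φ (x φ))⁻¹ (x φ)
  let D (φ : E →+* ℂ) (i : Module.Free.ChooseBasisIndex ℤ Λ) : MvPolynomial (ratH1 Λ × Λ) L :=
    P φ 1 (y i) - P φ (z φ (y i) * (z φ (x φ))⁻¹) (x φ)
  -- Negative exponents are moved to the other side to keep the relation polynomial.
  let M : MvPolynomial (ratH1 Λ × Λ) L :=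
    ∏ φ : Φ, C φ ^ (a φ).toNat - ∏ φ : Φ, C φ ^ (-a φ).toNat
  have hxσ : ∀ τ φ, eigenForm f (galHom (σ τ) φ) (x φ) ≠ 0 := fun τ φ => by
    rw [eigenForm_galHom_apply f hΦ]
    simpa using hx φ
  have hC : ∀ τ g φ, conjEval L τ (coeff Λ g) (C φ) =
      g (eigenForm f (galHom (σ τ) φ)) (x φ) / eigenForm f (galHom (σ τ) φ) (x φ) := by
    intro τ g φ
    rw [hP φ _ _ τ (σ τ) (hσ τ), ← hz, div_eq_inv_mul]
    congr 1
    simp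
  have hD : ∀ τ g φ i, conjEval L τ (coeff Λ g) (D φ i) =
      g (eigenForm f (galHom (σ τ) φ)) (y i) - conjEval L τ (coeff Λ g) (C φ) *
        eigenForm f (galHom (σ τ) φ) (y i) := by
    intro τ g φ i
    rw [hC, map_sub, hP φ _ _ τ (σ τ) (hσ τ), hP φ _ _ τ (σ τ) (hσ τ), ← hz, ← hz]
    simp only [IntermediateField.coe_mul, IntermediateField.coe_inv, map_mul, map_inv₀,
      IntermediateField.coe_one, map_one, one_mul]
    ring
  have hM : ∀ τ g, conjEval L τ (coeff Λ g) M =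
      ∏ φ : Φ, conjEval L τ (coeff Λ g) (C φ) ^ (a φ).toNat -
        ∏ φ : Φ, conjEval L τ (coeff Λ g) (C φ) ^ (-a φ).toNat := by
    intro τ g
    simp only [M, map_sub, map_prod, map_pow]
  have hrel : ∀ u : Φ → ℂˣ, ∏ φ, u φ ^ a φ = 1 ↔
      ∏ φ, (u φ : ℂ) ^ (a φ).toNat - ∏ φ, (u φ : ℂ) ^ (-a φ).toNat = 0 := by
    intro u
    simp only [units_zpow_eq, Finset.prod_mul_distrib, inv_pow, Finset.prod_inv_distrib]
    rw [mul_inv_eq_one, sub_eq_zero, ← Units.val_inj]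
    simp only [Units.coe_prod, Units.val_pow_eq_pow_val]
  have hdiag : ∀ τ g (χ : (E →+* ℂ) → ℂˣ),
      (∀ φ, g (eigenForm f φ) = (χ φ : ℂ) • eigenForm f φ) → ∀ φ,
        conjEval L τ (coeff Λ g) (C φ) = χ (galHom (σ τ) φ) := by
    intro τ g χ hχ φ
    rw [hC, hχ, LinearMap.smul_apply, smul_eq_mul, mul_div_cancel_right₀ _ (hxσ τ φ)]
  obtain ⟨S', hS'⟩ := exists_rat_polynomials L (coeff Λ)
    (insert M (Set.range fun i : (E →+* ℂ) × _ => D i.1 i.2))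
  refine ⟨S', fun g => Iff.trans ⟨?_, fun h => ?_⟩ (hS' g)⟩
  · rintro ⟨χ, hχ, hχa⟩ Q hQ τ
    rcases hQ with rfl | ⟨⟨φ, i⟩, rfl⟩
    · rw [hM]
      simp only [hdiag τ g χ hχ]
      exact (hrel _).1 (hχa τ)
    · rw [hD, hdiag τ g χ hχ, hχ, LinearMap.smul_apply, smul_eq_mul, sub_self]
  · have hself : ∀ φ : E →+* ℂ, galHom (σ 1) φ = φ := galHom_eq_self hL (hσ 1)
    have hg : ∀ φ, g (eigenForm f φ) = conjEval L 1 (coeff Λ g) (C φ) • eigenForm f φ := fun φ => by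
      refine (latticeBasis Λ).ext fun i => ?_
      have := h (D φ i) (Or.inr ⟨(φ, i), rfl⟩) 1
      rw [hD, hself, sub_eq_zero] at this
      exact this
    have hne : ∀ φ, conjEval L 1 (coeff Λ g) (C φ) ≠ 0 := fun φ h0 => by
      have := hg φ
      rw [h0, zero_smul] at this
      exact eigenForm_ne_zero f hΦ φ (g.map_eq_zero_iff.1 this)
    let χ (φ : E →+* ℂ) : ℂˣ := Units.mk0 _ (hne φ)
    refine ⟨χ, hg, fun τ => ?_⟩
    rw [hrel]
    have := h M (Or.inl rfl) τ
    rw [hM] at this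
    simp only [hdiag τ g χ hg] at this
    exact this

/-- The Mumford-Tate group satisfies the multiplicative relations with balanced exponents. -/
lemma mumfordTate_le_relationSubgroup (hΦ : IsCMType Φ) (L : IntermediateField ℚ ℂ)
    [FiniteDimensional ℚ L] [IsGalois ℚ L] (hL : ∀ (φ : E →+* ℂ) e, φ e ∈ L)
    (σ : (L ≃ₐ[ℚ] L) → (ℂ ≃+* ℂ)) (hσ : ∀ τ (l : L), σ τ l = τ l) (a : Φ → ℤ)
    (ha : ∀ σ : ℂ ≃+* ℂ, ∑ φ, a φ * embSign Φ (galHom σ φ) = 0) :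
    mumfordTate Λ ≤ relationSubgroup f σ a := by
  classical
  refine sInf_le ⟨relationSubgroup_isAlgebraicOverQ f hΦ L hL σ hσ a, fun z => ?_⟩
  let w : ℂˣ := Units.mk0 (conj (z : ℂ)) (by simp)
  refine ⟨fun φ => if φ ∈ Φ then z else w, fun φ => ?_, fun τ => ?_⟩
  · rw [hodgeAct_eigenForm f hΦ]
    by_cases h : φ ∈ Φ <;> simp [h, w]
  -- Balance at the identity says the exponents sum to 0. With balance at σ, the partial sums over
  -- σφ ∈ Φ and σφ ∉ Φ both vanish, which kills the powers of z and of conj z separately.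
  · have h0 : ∑ φ : Φ, a φ = 0 := by
      have := ha (RingEquiv.refl ℂ)
      rw [← this]
      refine Finset.sum_congr rfl fun φ _ => ?_
      have : galHom (RingEquiv.refl ℂ) (φ : E →+* ℂ) = φ := rfl
      rw [this, embSign, if_pos φ.2, mul_one]
    have h1 := ha (σ τ)
    have hs : ∀ φ : Φ, (if galHom (σ τ) φ ∈ Φ then z else w) ^ a φ =
        z ^ (if galHom (σ τ) φ ∈ Φ then a φ else 0) *
          w ^ (if galHom (σ τ) φ ∈ Φ then 0 else a φ) := fun φ => by
      split_ifs <;> simp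
    simp only [hs, Finset.prod_mul_distrib, prod_zpow_eq_zpow_sum]
    have e1 : ∑ φ : Φ, a φ = ∑ φ : Φ, (if galHom (σ τ) φ ∈ Φ then a φ else 0) +
        ∑ φ : Φ, (if galHom (σ τ) φ ∈ Φ then 0 else a φ) := by
      rw [← Finset.sum_add_distrib]
      exact Finset.sum_congr rfl fun φ _ => by split_ifs <;> simp
    have e2 : ∑ φ : Φ, a φ * embSign Φ (galHom (σ τ) φ) =
        ∑ φ : Φ, (if galHom (σ τ) φ ∈ Φ then a φ else 0) -
        ∑ φ : Φ, (if galHom (σ τ) φ ∈ Φ then 0 else a φ) := by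
      rw [← Finset.sum_sub_distrib]
      exact Finset.sum_congr rfl fun φ _ => by rw [embSign]; split_ifs <;> simp
    rw [e1] at h0
    rw [e2] at h1
    have e3 : ∑ φ : Φ, (if galHom (σ τ) φ ∈ Φ then a φ else 0) = 0 := by omega
    have e4 : ∑ φ : Φ, (if galHom (σ τ) φ ∈ Φ then 0 else a φ) = 0 := by omega
    rw [e3, e4, zpow_zero, zpow_zero, one_mul]

variable {ψ : LinearMap.BilinForm ℂ (H1 V)}

/-- The elements of `T` are diagonal in the eigenforms. -/
lemma exists_torusT_char (hΦ : IsCMType Φ) (ψ : LinearMap.BilinForm ℂ (H1 V)) (t : torusT f ψ) :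
    ∃ χ : (E →+* ℂ) → ℂˣ,
      ∀ φ, (t : GLH1 V) (eigenForm f φ) = (χ φ : ℂ) • eigenForm f φ := by
  have key : ∀ T ∈ Algebra.adjoin ℂ (Set.range fun e => pullback (cmAct f e)), ∀ φ,
      ∃ c : ℂ, T (eigenForm f φ) = c • eigenForm f φ := by
    intro T hT φ
    induction hT using Algebra.adjoin_induction with
    | mem T hT =>
      obtain ⟨e, rfl⟩ := hT
      exact ⟨_, pullback_cmAct_eigenForm f hΦ φ e⟩
    | algebraMap c => exact ⟨c, rfl⟩
    | add S T _ _ hS hT =>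
      obtain ⟨c, hc⟩ := hS
      obtain ⟨d, hd⟩ := hT
      exact ⟨c + d, by rw [LinearMap.add_apply, hc, hd, add_smul]⟩
    | mul S T _ _ hS hT =>
      obtain ⟨c, hc⟩ := hS
      obtain ⟨d, hd⟩ := hT
      exact ⟨d * c, by rw [Module.End.mul_apply, hd, map_smul, hc, smul_smul]⟩
  choose c hc using key _ t.2.1.1
  have hc' : ∀ φ, (t : GLH1 V) (eigenForm f φ) = c φ • eigenForm f φ := hc
  refine ⟨fun φ => Units.mk0 (c φ) fun h0 => eigenForm_ne_zero f hΦ φ ?_, hc'⟩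
  refine (t : GLH1 V).map_eq_zero_iff.1 ?_
  rw [hc', h0, zero_smul]

lemma units_eq_of_smul_eigenForm (hΦ : IsCMType Φ) {φ : E →+* ℂ} {c d : ℂˣ}
    (h : (c : ℂ) • eigenForm f φ = (d : ℂ) • eigenForm f φ) : c = d :=
  Units.ext (smul_left_injective ℂ (eigenForm_ne_zero f hΦ φ) h)

/-- Balanced exponents are the coordinates of a character in `N`. -/
lemma exists_mem_kernelN (hΦ : IsCMType Φ) (L : IntermediateField ℚ ℂ)
    [FiniteDimensional ℚ L] [IsGalois ℚ L] (hL : ∀ (φ : E →+* ℂ) e, φ e ∈ L)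
    {ω : (E →+* ℂ) → H1 V} (hω : IsEigenbasis f ω) (a : Φ → ℤ)
    (ha : ∀ σ : ℂ ≃+* ℂ, ∑ φ, a φ * embSign Φ (galHom σ φ) = 0) :
    ∃ α ∈ kernelN Λ (torusT f ψ), HasCoords f ψ ω α a 0 := by
  choose χ hχ using exists_torusT_char f hΦ ψ
  let α : torusT f ψ →* ℂˣ :=
    { toFun := fun t => ∏ φ : Φ, χ t φ ^ a φ
      map_one' := by
        refine Finset.prod_eq_one fun φ _ => ?_
        have : χ 1 φ = 1 := units_eq_of_smul_eigenForm f hΦ (φ := φ) (by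
          rw [← hχ]; simp)
        rw [this, one_zpow]
      map_mul' := fun s t => by
        rw [← Finset.prod_mul_distrib]
        refine Finset.prod_congr rfl fun φ _ => ?_
        have : χ (s * t) φ = χ s φ * χ t φ := units_eq_of_smul_eigenForm f hΦ (φ := φ) (by
          rw [← hχ, Subgroup.coe_mul, LinearEquiv.mul_apply, hχ, map_smul, hχ, smul_smul, mul_comm]
          rfl)
        rw [this, mul_zpow] }
  have hα : ∀ t, α t = ∏ φ : Φ, χ t φ ^ a φ := fun t => rfl
  refine ⟨α, ⟨?_, fun t ht => ?_⟩, fun t c χ' _ hχ' => ?_⟩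
  · choose P hP using exists_polynomial_eval_eigenForm f hΦ L hL
    choose x hx using exists_eigenForm_apply_ne_zero f hΦ
    let z (φ : E →+* ℂ) : L := ⟨eigenForm f φ (x φ), eigenForm_mem_field f hL hΦ φ _⟩
    let C (φ : E →+* ℂ) : MvPolynomial (ratH1 Λ × Λ) ℂ :=
      (P φ (z φ)⁻¹ (x φ)).map (algebraMap L ℂ)
    have hC : ∀ (g : GLH1 V) (c : ℂ) φ, g (eigenForm f φ) = c • eigenForm f φ →
        MvPolynomial.aeval (coeff Λ g) (C φ) = c := by
      intro g c φ hg
      have h1 : MvPolynomial.aeval (coeff Λ g) (C φ) =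
          conjEval L 1 (coeff Λ g) (P φ (z φ)⁻¹ (x φ)) := by
        rw [MvPolynomial.aeval_def, MvPolynomial.eval₂_map]
        rfl
      rw [h1, hP φ _ _ 1 (RingEquiv.refl ℂ) (fun l => rfl) g,
        show galHom (RingEquiv.refl ℂ) φ = φ from rfl, hg, LinearMap.smul_apply, smul_eq_mul,
        RingEquiv.refl_apply]
      simp only [IntermediateField.coe_inv, z]
      field_simp [hx φ]
    -- Positive exponents use the coefficients of t, negative ones those of t⁻¹.
    refine ⟨∏ φ : Φ, ((C φ).rename Sum.inl ^ (a φ).toNat * (C φ).rename Sum.inr ^ (-a φ).toNat),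
      fun t => ?_⟩
    have hinv : ∀ φ, (t : GLH1 V)⁻¹ (eigenForm f φ) = ((χ t φ)⁻¹ : ℂˣ) • eigenForm f φ := fun φ => by
      apply (t : GLH1 V).injective
      change (t : GLH1 V) ((t : GLH1 V).symm _) = (t : GLH1 V) ((((χ t φ)⁻¹ : ℂˣ) : ℂ) • _)
      rw [(t : GLH1 V).apply_symm_apply, map_smul, hχ, smul_smul]
      simp
    rw [hα, map_prod, Units.coe_prod]
    refine Finset.prod_congr rfl fun φ _ => ?_
    rw [map_mul, map_pow, map_pow, MvPolynomial.aeval_rename, MvPolynomial.aeval_rename,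
      Sum.elim_comp_inl, Sum.elim_comp_inr, hC _ _ _ (hχ t φ), hC _ _ _ (hinv φ), units_zpow_eq]
    simp
  -- Triviality on the Mumford-Tate group is the relation for τ = 1, as `σ 1` fixes every embedding.
  · choose σ hσ using fun τ : L ≃ₐ[ℚ] L => exists_ringEquiv_extending (τ : L ≃+* L)
    obtain ⟨χ', h1, h2⟩ := mumfordTate_le_relationSubgroup f hΦ L hL σ hσ a ha ht
    rw [hα, ← h2 1]
    refine Finset.prod_congr rfl fun φ _ => ?_
    rw [galHom_eq_self hL (hσ 1)]
    congr 1
    exact units_eq_of_smul_eigenForm f hΦ (φ := φ) (by rw [← hχ, h1])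
  · obtain ⟨c, hc⟩ := hω.exists_smul f hΦ
    rw [zpow_zero, mul_one, hα]
    refine Finset.prod_congr rfl fun φ _ => ?_
    congr 1
    refine units_eq_of_smul_eigenForm f hΦ (φ := φ) ?_
    have := hχ' φ
    rw [hc, map_smul, hχ, smul_comm _ (c _ : ℂ)] at this
    exact smul_right_injective _ (c φ).ne_zero this

end Characters

/-! ### Conjugate pairs -/

section Combinatorics

variable {E : Type*} [CommRing E] {Φ : Finset (E →+* ℂ)} {n : ℕ}

/-- The number of copies of `φ` in `Q`. -/
def copyCount (Q : Finset (EmbCopies E n)) (φ : E →+* ℂ) : ℕ :=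
  {ℓ : Fin n | (φ, ℓ) ∈ Q}.ncard

lemma copyCount_le (Q : Finset (EmbCopies E n)) (φ : E →+* ℂ) : copyCount Q φ ≤ n := by
  have := Set.ncard_le_card {ℓ : Fin n | (φ, ℓ) ∈ Q}
  rw [Nat.card_eq_fintype_card, Fintype.card_fin] at this
  exact this

lemma copyCount_eq_zero_iff {Q : Finset (EmbCopies E n)} {φ : E →+* ℂ} :
    copyCount Q φ = 0 ↔ ∀ ℓ, (φ, ℓ) ∉ Q := by
  rw [copyCount, Set.ncard_eq_zero (Set.toFinite _), Set.eq_empty_iff_forall_notMem]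
  rfl

lemma embSign_conjHom (hΦ : IsCMType Φ) (φ : E →+* ℂ) :
    embSign Φ (conjHom φ) = -embSign Φ φ := by
  by_cases h : φ ∈ Φ
  · simp [embSign, h, hΦ.conjHom_notMem h]
  · simp [embSign, h, hΦ.conjHom_mem h]

lemma sum_emb_eq_sum_type [Fintype (E →+* ℂ)] (hΦ : IsCMType Φ) (F : (E →+* ℂ) → ℤ) :
    ∑ φ, F φ = ∑ φ : Φ, (F φ + F (conjHom φ)) := by
  classical
  rw [Finset.sum_add_distrib, ← Finset.sum_add_sum_compl Φ F, ← Finset.sum_coe_sort Φ]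
  congr 1
  rw [Finset.sum_coe_sort Φ fun φ => F (conjHom φ)]
  refine Finset.sum_nbij' conjHom conjHom (fun φ h => ?_) (fun φ h => ?_) (fun φ _ => by simp)
    (fun φ _ => by simp) (fun φ _ => by simp)
  · exact hΦ.conjHom_mem (by simpa using h)
  · simpa using hΦ.conjHom_notMem h

/-- The sum over `Q` of a function that is odd under complex conjugation. -/
lemma sum_odd_eq (hΦ : IsCMType Φ) {g : (E →+* ℂ) → ℤ} (hg : ∀ φ, g (conjHom φ) = -g φ)
    (Q : Finset (EmbCopies E n)) :
    ∑ s ∈ Q, g s.1 = ∑ φ : Φ, ((copyCount Q φ : ℤ) - copyCount Q (conjHom φ)) * g φ := by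
  classical
  have := hΦ.finite
  have := Fintype.ofFinite (E →+* ℂ)
  have h1 : ∑ s ∈ Q, g s.1 = ∑ φ, (copyCount Q φ : ℤ) * g φ := by
    have h := Finset.sum_ite_mem Finset.univ Q fun s => g s.1
    rw [Finset.univ_inter] at h
    rw [← h, Fintype.sum_prod_type]
    refine Finset.sum_congr rfl fun φ _ => ?_
    dsimp only
    rw [← Finset.sum_filter, Finset.sum_const, nsmul_eq_mul, copyCount,
      Set.ncard_eq_toFinset_card']
    simp
  rw [h1, sum_emb_eq_sum_type hΦ]
  refine Finset.sum_congr rfl fun φ _ => ?_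
  rw [hg]
  ring

/-- The two members of a conjugate pair cancel, so balance is insensitive to adding pairs. -/
lemma sum_pairExtension {g : (E →+* ℂ) → ℤ} (hg : ∀ φ, g (conjHom φ) = -g φ)
    {P Q : Finset (EmbCopies E n)} {L : List (Φ × Fin n × Fin n)} (h : IsPairExtension P L Q) :
    ∑ s ∈ Q, g s.1 = ∑ s ∈ P, g s.1 := by
  have hL : ((pairList L).map fun s => g s.1).sum = 0 := by
    clear h
    induction L with
    | nil => simp [pairList]
    | cons x L ih =>
      rw [pairList, List.flatMap_cons, List.map_append, List.sum_append]
      change _ + ((pairList L).map fun s => g s.1).sum = 0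
      rw [ih]
      simp [hg]
  change (Q.val.map fun s => g s.1).sum = (P.val.map fun s => g s.1).sum
  rw [h, Multiset.map_add, Multiset.sum_add, Multiset.map_coe, Multiset.sum_coe, hL, add_zero]

/-- Every set is obtained by adding conjugate pairs to a set without conjugate pairs. -/
lemma exists_isPairExtension (hΦ : IsCMType Φ) (Q : Finset (EmbCopies E n)) :
    ∃ (P : Finset (EmbCopies E n)) (L : List (Φ × Fin n × Fin n)), IsPairExtension P L Q ∧
      ∀ φ : Φ, copyCount P φ = 0 ∨ copyCount P (conjHom φ) = 0 := by
  classical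
  induction hk : Q.card using Nat.strong_induction_on generalizing Q with
  | _ k ih =>
    by_cases hQ : ∀ φ : Φ, copyCount Q φ = 0 ∨ copyCount Q (conjHom φ) = 0
    · exact ⟨Q, [], by simp [IsPairExtension, pairList], hQ⟩
    · push Not at hQ
      obtain ⟨φ, h1, h2⟩ := hQ
      simp only [ne_eq, copyCount_eq_zero_iff, not_forall, not_not] at h1 h2
      obtain ⟨ℓ, hℓ⟩ := h1
      obtain ⟨ℓ', hℓ'⟩ := h2
      have hne : ((conjHom (φ : E →+* ℂ), ℓ') : EmbCopies E n) ≠ ((φ : E →+* ℂ), ℓ) := fun h => by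
        have h3 : conjHom (φ : E →+* ℂ) = φ := congrArg Prod.fst h
        exact hΦ.conjHom_notMem φ.2 (h3.symm ▸ φ.2 : conjHom (φ : E →+* ℂ) ∈ Φ)
      have hmem : ((conjHom (φ : E →+* ℂ), ℓ') : EmbCopies E n) ∈ Q.erase ((φ : E →+* ℂ), ℓ) :=
        Finset.mem_erase.2 ⟨hne, hℓ'⟩
      obtain ⟨P, L, hPL, hP⟩ := ih _ (by
        rw [← hk]
        exact (Finset.card_erase_lt_of_mem hmem).trans (Finset.card_erase_lt_of_mem hℓ))
        ((Q.erase ((φ : E →+* ℂ), ℓ)).erase (conjHom (φ : E →+* ℂ), ℓ')) rfl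
      refine ⟨P, (φ, ℓ, ℓ') :: L, ?_, hP⟩
      have e1 : Q.val = ((φ : E →+* ℂ), ℓ) ::ₘ (conjHom (φ : E →+* ℂ), ℓ') ::ₘ
          ((Q.erase ((φ : E →+* ℂ), ℓ)).erase (conjHom (φ : E →+* ℂ), ℓ')).val := by
        rw [Finset.erase_val, Multiset.cons_erase hmem, Finset.erase_val,
          Multiset.cons_erase hℓ]
      rw [IsPairExtension, e1, hPL]
      change _ = P.val + (((φ : E →+* ℂ), ℓ) ::ₘ (conjHom (φ : E →+* ℂ), ℓ') ::ₘ 0 +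
        (pairList L : Multiset _))
      rw [Multiset.cons_add, Multiset.cons_add, zero_add, Multiset.add_cons, Multiset.add_cons]

end Combinatorics

/-! ### Admissible sets, the basis and the products -/

section Main

variable {E : Type*} [CommRing E] {Φ : Finset (E →+* ℂ)} {n : ℕ}
variable {V : Type*} [NormedAddCommGroup V] [NormedSpace ℂ V] [FiniteDimensional ℂ V]
  {Λ : Submodule ℤ V} [DiscreteTopology Λ] [IsZLattice ℝ Λ] (f : Isogeny Λ (cmLattice Φ))
  {ψ : LinearMap.BilinForm ℂ (H1 V)} {ω : (E →+* ℂ) → H1 V}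

/-- The admissible sets are the balanced ones. -/
lemma exists_kernelSets_iff_isBalanced [Algebra ℚ E] [Module.Finite ℚ E]
    (hE : HasComplexConj E) (hΦ : IsCMType Φ) (hψ : IsPolarization Λ ψ)
    (hω : IsEigenbasis f ω) (Q : Finset (EmbCopies E n)) :
    (∃ P ∈ kernelSets f ψ ω n, ∃ L : List (Φ × Fin n × Fin n), IsPairExtension P L Q) ↔
      IsBalanced Φ Q := by
  have hodd : ∀ (σ : ℂ ≃+* ℂ) (φ : E →+* ℂ),
      embSign Φ (galHom σ (conjHom φ)) = -embSign Φ (galHom σ φ) := fun σ φ => by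
    rw [hE.galHom_conjHom, embSign_conjHom hΦ]
  constructor
  · rintro ⟨P, ⟨α, hα, a, a₀, ha, -, hP⟩, L, hL⟩ σ
    rw [sum_pairExtension (g := fun φ => embSign Φ (galHom σ φ)) (hodd σ) hL,
      sum_odd_eq (g := fun φ => embSign Φ (galHom σ φ)) hΦ (hodd σ),
      ← sum_embSign_of_mem_kernelN f hψ hΦ hω hα ha σ]
    refine Finset.sum_congr rfl fun φ _ => ?_
    rw [copyCount, copyCount, (hP φ).1, (hP φ).2]
    congr 1
    omega
  · intro hQ
    obtain ⟨P, L, hPL, hP⟩ := exists_isPairExtension hΦ Q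
    obtain ⟨K, _, _, hK⟩ := exists_galois_subfield E
    -- For sums odd under conjugation only this difference matters, so balance of Q becomes balance
    -- of the exponents.
    let a (φ : Φ) : ℤ := copyCount P φ - copyCount P (conjHom φ)
    have ha : ∀ σ : ℂ ≃+* ℂ, ∑ φ, a φ * embSign Φ (galHom σ φ) = 0 := fun σ => by
      rw [← sum_odd_eq (g := fun φ => embSign Φ (galHom σ φ)) hΦ (hodd σ),
        ← sum_pairExtension (g := fun φ => embSign Φ (galHom σ φ)) (hodd σ) hPL]
      exact hQ σ
    obtain ⟨α, hα, hαa⟩ := exists_mem_kernelN (ψ := ψ) f hΦ K hK hω a ha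
    refine ⟨P, ⟨α, hα, a, 0, hαa, fun φ => ?_, fun φ => ?_⟩, L, hPL⟩
    · have h1 := copyCount_le P φ
      have h2 := copyCount_le P (conjHom φ)
      rw [abs_le]
      constructor <;> dsimp only [a] <;> omega
    -- Since P contains no conjugate pair, one of the two counts is 0 and the other is |a_φ|.
    · change copyCount P φ = _ ∧ copyCount P (conjHom φ) = _
      have := hP φ
      dsimp only [a]
      omega

variable [LinearOrder (EmbCopies E n)]

lemma hodgeRingC_eq_span [Algebra ℚ E] [Module.Finite ℚ E] (hΦ : IsCMType Φ) :
    hodgeRingC (powLattice Λ n) =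
      Submodule.span ℂ (wedgeOf (eigenForm f) '' {Q : Finset (EmbCopies E n) | IsBalanced Φ Q}) := by
  refine le_antisymm (hodgeRingC_le_span f hΦ) (Submodule.span_le.2 ?_)
  obtain ⟨K, _, _, hK⟩ := exists_galois_subfield E
  rintro _ ⟨Q, hQ, rfl⟩
  exact wedgeOf_mem_hodgeRingC f K hΦ hK hQ

/-- The balanced classes form a basis of `B ⊗ ℂ`. -/
lemma exists_basis_hodgeRingC [Algebra ℚ E] [Module.Finite ℚ E] (hΦ : IsCMType Φ)
    (hω : IsEigenbasis f ω) {p : Finset (EmbCopies E n) → Prop}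
    (hp : ∀ Q, p Q ↔ IsBalanced Φ Q) :
    ∃ b : Module.Basis {Q // p Q} ℂ (hodgeRingC (powLattice Λ n)),
      ∀ Q, (b Q : Coh (Fin n → V)) = wedgeOf ω Q.1 := by
  obtain ⟨c, hc⟩ := hω.exists_smul f hΦ
  -- Rescaling each eigenform multiplies [Q] by a unit, so an arbitrary eigenbasis also gives a
  -- basis of the cohomology.
  let b₀ := (copyBasis n (eigenBasis f hΦ)).ExteriorAlgebra.unitsSMul
    fun Q : Finset (EmbCopies E n) => ∏ s ∈ Q, c s.1
  have hb₀ : ∀ Q, b₀ Q = wedgeOf ω Q := fun Q => by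
    rw [Module.Basis.unitsSMul_apply, wedgeOf_smul c hc, wedgeOf_eigenForm f hΦ]
  have hli : LinearIndependent ℂ fun Q : {Q // p Q} => wedgeOf ω (V := V) Q.1 := by
    have := b₀.linearIndependent.comp (fun Q : {Q // p Q} => Q.1) Subtype.val_injective
    simpa only [Function.comp_def, hb₀] using this
  have hspan : Submodule.span ℂ (Set.range fun Q : {Q // p Q} => wedgeOf ω (V := V) Q.1) =
      hodgeRingC (powLattice Λ n) := by
    rw [hodgeRingC_eq_span f hΦ]
    apply le_antisymm <;> rw [Submodule.span_le]
    · rintro _ ⟨Q, rfl⟩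
      dsimp only
      rw [wedgeOf_smul c hc, Units.smul_def]
      exact Submodule.smul_mem _ _ (Submodule.subset_span ⟨Q.1, (hp _).1 Q.2, rfl⟩)
    · rintro _ ⟨Q, hQ, rfl⟩
      have : wedgeOf (eigenForm f) Q = (∏ s ∈ Q, c s.1)⁻¹ • wedgeOf ω Q := by
        rw [wedgeOf_smul c hc, inv_smul_smul]
      rw [SetLike.mem_coe, this, Units.smul_def]
      exact Submodule.smul_mem _ _ (Submodule.subset_span ⟨⟨Q, (hp _).2 hQ⟩, rfl⟩)
  refine ⟨(Module.Basis.span hli).map (LinearEquiv.ofEq _ _ hspan), fun Q => ?_⟩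
  rw [Module.Basis.map_apply, LinearEquiv.coe_ofEq_apply, Module.Basis.span_apply]

omit [FiniteDimensional ℂ V] in
lemma wedgeOf_mul_pairProd (ω : (E →+* ℂ) → H1 V) {P Q : Finset (EmbCopies E n)}
    {L : List (Φ × Fin n × Fin n)} (h : IsPairExtension P L Q) :
    wedgeOf ω P * pairProd ω L = wedgeOf ω Q ∨ wedgeOf ω P * pairProd ω L = -wedgeOf ω Q := by
  have hL : pairProd ω L =
      ((pairList L).map fun s => ExteriorAlgebra.ι ℂ (copyClass ω s)).prod := by
    clear h
    induction L with
    | nil => simp [pairProd, pairList]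
    | cons x L ih =>
      rw [pairList, List.flatMap_cons, List.map_append, List.prod_append]
      change _ = _ * ((pairList L).map fun s => ExteriorAlgebra.ι ℂ (copyClass ω s)).prod
      rw [← ih]
      simp [pairProd]
  rw [hL, wedgeOf, ← List.prod_append, ← List.map_append]
  refine wedgeOf_eq_or_eq_neg ω Q ?_
  rw [h, ← Multiset.coe_add, Finset.sort_eq]

end Main

end CMHodge

end

theorem mainTheorem9 {ι : Type*} [Fintype ι] (K : ι → Type*) [∀ i, Field (K i)]
    [∀ i, NumberField (K i)] [∀ i, NumberField.IsCMField (K i)]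
    (Φ : Finset ((∀ i, K i) →+* ℂ)) (hΦ : CMHodge.IsCMType Φ)
    {V : Type*} [NormedAddCommGroup V] [NormedSpace ℂ V] [FiniteDimensional ℂ V]
    (Λ : Submodule ℤ V) [DiscreteTopology Λ] [IsZLattice ℝ Λ]
    (f : CMHodge.Isogeny Λ (CMHodge.cmLattice Φ))
    (ψ : LinearMap.BilinForm ℂ (CMHodge.H1 V)) (hψ : CMHodge.IsPolarization Λ ψ)
    (ω : ((∀ i, K i) →+* ℂ) → CMHodge.H1 V) (hω : CMHodge.IsEigenbasis f ω)
    (n : ℕ) (hn : 1 ≤ n) [LinearOrder (CMHodge.EmbCopies (∀ i, K i) n)] :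
    (∀ α ∈ CMHodge.kernelN Λ (CMHodge.torusT f ψ), ∀ (a : Φ → ℤ) (a₀ : ℤ),
      CMHodge.HasCoords f ψ ω α a a₀ → (∀ φ, |a φ| ≤ n) →
      ∀ P : Finset (CMHodge.EmbCopies (∀ i, K i) n), CMHodge.IsAssigned a P →
        CMHodge.wedgeOf ω P ∈ CMHodge.hodgeRingC (CMHodge.powLattice Λ n)) ∧
    (∀ (P Q : Finset (CMHodge.EmbCopies (∀ i, K i) n)) (L : List (Φ × Fin n × Fin n)),
      P ∈ CMHodge.kernelSets f ψ ω n → CMHodge.IsPairExtension P L Q →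
        CMHodge.wedgeOf ω P * CMHodge.pairProd ω L = CMHodge.wedgeOf ω Q ∨
        CMHodge.wedgeOf ω P * CMHodge.pairProd ω L = -CMHodge.wedgeOf ω Q) ∧
    ∃ b : Module.Basis
        {Q : Finset (CMHodge.EmbCopies (∀ i, K i) n) //
          ∃ P ∈ CMHodge.kernelSets f ψ ω n, ∃ L : List (Φ × Fin n × Fin n),
            CMHodge.IsPairExtension P L Q}
        ℂ (CMHodge.hodgeRingC (CMHodge.powLattice Λ n)),
      ∀ Q, (b Q : CMHodge.Coh (Fin n → V)) = CMHodge.wedgeOf ω Q.1 := by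
  obtain ⟨b, hb⟩ := CMHodge.exists_basis_hodgeRingC f hΦ hω
    (CMHodge.exists_kernelSets_iff_isBalanced f (CMHodge.hasComplexConj_pi K) hΦ hψ hω (n := n))
  refine ⟨fun α hα a a₀ ha han P hP => ?_, fun P Q L _ h => CMHodge.wedgeOf_mul_pairProd ω h,
    b, hb⟩
  -- P itself is admissible, with no pairs added.
  rw [← hb ⟨P, P, ⟨α, hα, a, a₀, ha, han, hP⟩, [], by
    simp [CMHodge.IsPairExtension, CMHodge.pairList]⟩]
  exact (b _).2
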